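/- Let $R$ and $S$ be associative rings with unit, not necessarily commutative, and let ${}_SC_R$ be a faithfully semidualizing bimodule; that is, $C$ is an $(S,R)$-bimodule such that - ${}_SC$ and $C_R$ both admit projective resolutions by finitely generated projective modules; - the homothety maps $S\to \operatorname{Hom}_{R^{op}}(C,C)$ and $R\to\operatorname{Hom}_S(C,C)$ are isomorphisms; - $\operatorname{Ext}^i_S(C,C)=0=\operatorname{Ext}^i_{R^{op}}(C,C)$ for all $i\ge 1$; - for all modules ${}_SN$ and $M_R$, if $\operatorname{Hom}_S(C,N)=0$ then $N=0$, and if $\operatorname{Hom}_{R^{op}}(C,M)=0$ then $M=0$. A module is *super finitely presented* if it has a projective resolution by finitely generated projective modules. For a ring $A$ and a left $A$-module $M$, the *weak injective dimension* $\operatorname{wid}_A(M)$ (respectively the *weak flat dimension* $\operatorname{wfd}_A(M)$) is the least $n\ge 0$ such that $\operatorname{Ext}_A^{n+1}(F,M)=0$ for every super finitely presented left $A$-module $F$ (respectively $\operatorname{Tor}^A_{n+1}(F,M)=0$ for every super finitely presented right $A$-module $F$), and $\infty$ if there is no such $n$. The module $M$ is *weak injective* (respectively *weak flat*) if $\operatorname{Ext}^1_A(F,M)=0$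 (respectively $\operatorname{Tor}_1^A(F,M)=0$) for all such $F$. For a left $S$-module $M$, $C\text{-}\operatorname{wfd}_S(M)$ is the least $n\ge 0$ for which there is an exact sequence of left $S$-modules $$0\to C\otimes_RF_n\to\cdots\to C\otimes_RF_0\to M\to 0$$ with all $F_i$ weak flat left $R$-modules. For a left $R$-module $M$, $C\text{-}\operatorname{wid}_R(M)$ is the least $n\ge 0$ for which there is an exact sequence of left $R$-modules $$0\to M\to\operatorname{Hom}_S(C,I^0)\to\cdots\to\operatorname{Hom}_S(C,I^n)\to 0$$ with all $I^i$ weak injective left $S$-modules. Both are $\infty$ if there is no such $n$. Then the following equalities hold in $\{0,1,2,\dots\}\cup\{\infty\}$. 1. $\operatorname{wfd}_R(M)=C\text{-}\operatorname{wfd}_S(C\otimes_RM)$ for every left $R$-module $M$. 2. $\operatorname{wid}_S(M)=C\text{-}\operatorname{wid}_R(\operatorname{Hom}_S(C,M))$ for every left $S$-module $M$. 3. $C\text{-}\operatorname{wid}_R(M)=\operatorname{wid}_S(C\otimes_RM)$ for every left $R$-module $M$. 4. $C\text{-}\operatorname{wfd}_S(M)=\operatorname{wfd}_R(\operatorname{Hom}_S(C,M))$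 for every left $S$-module $M$. -/

import Mathlib

open CategoryTheory MulOpposite
open scoped TensorProduct

universe u

/-! An `(S, R)`-bimodule `C` is a left `S`-module that is also a left `Rᵐᵒᵖ`-module (that is, a
right `R`-module, `c r = op r • c`), the two actions commuting (`SMulCommClass S Rᵐᵒᵖ C`). -/

noncomputable section

section Tensor

variable (S R C M : Type*) [Ring S] [Ring R] [AddCommGroup C] [Module S C] [Module Rᵐᵒᵖ C]
  [AddCommGroup M] [Module R M]

/-- The relations `c r ⊗ m = c ⊗ r m` in `C ⊗_ℤ M`. When `C` is an `(S, R)`-bimodule, the generating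
set is stable under `S`, so that the `S`-span is the additive subgroup generated. -/
def balancedRel : Submodule S (C ⊗[ℤ] M) :=
  Submodule.span S {t | ∃ (c : C) (r : R) (m : M), t = (op r • c) ⊗ₜ[ℤ] m - c ⊗ₜ[ℤ] (r • m)}

/-- The tensor product `C ⊗_R M` of an `(S, R)`-bimodule `C` and a left `R`-module `M` over a not
necessarily commutative ring `R`, as a left `S`-module. For a bare right `R`-module take `S = ℤ`. -/
abbrev BalancedTensor : Type _ := (C ⊗[ℤ] M) ⧸ balancedRel S R C M

end Tensor

section Hom

section

variable {S R : Type*} [Ring S] [Ring R] (C : Type*) [AddCommGroup C] [Module S C] [Module Rᵐᵒᵖ C]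
  [SMulCommClass S Rᵐᵒᵖ C]

/-- Left multiplication `c ↦ s c` on an `(S, R)`-bimodule, as a map of right `R`-modules. -/
def leftHomothety (s : S) : C →ₗ[Rᵐᵒᵖ] C where
  toFun c := s • c
  map_add' := smul_add s
  map_smul' r c := smul_comm s r c

/-- Right multiplication `c ↦ c r` on an `(S, R)`-bimodule, as a map of left `S`-modules. -/
def rightHomothety (r : R) : C →ₗ[S] C where
  toFun c := op r • c
  map_add' := smul_add (op r)
  map_smul' s c := (smul_comm s (op r) c).symm

end

/-- `Hom_S(C, N)` for an `(S, R)`-bimodule `C`. It is a type of its own because it carries the left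
`R`-action `(r f)(c) = f(c r)` below. -/
def BimodHom (S R C N : Type*) [Ring S] [Ring R] [AddCommGroup C] [Module S C] [Module Rᵐᵒᵖ C]
    [SMulCommClass S Rᵐᵒᵖ C] [AddCommGroup N] [Module S N] : Type _ :=
  C →ₗ[S] N

variable (S R C N : Type*) [Ring S] [Ring R] [AddCommGroup C] [Module S C] [Module Rᵐᵒᵖ C]
  [SMulCommClass S Rᵐᵒᵖ C] [AddCommGroup N] [Module S N]

instance : AddCommGroup (BimodHom S R C N) := inferInstanceAs (AddCommGroup (C →ₗ[S] N))

instance : Module R (BimodHom S R C N) where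
  smul r f := (show C →ₗ[S] N from f).comp (rightHomothety C r)
  one_smul f := LinearMap.ext fun c =>
    congrArg (show C →ₗ[S] N from f) (one_smul Rᵐᵒᵖ c)
  mul_smul r s f := LinearMap.ext fun c =>
    congrArg (show C →ₗ[S] N from f) (mul_smul (op s) (op r) c)
  smul_zero _ := rfl
  smul_add _ _ _ := rfl
  add_smul r s f := LinearMap.ext fun c =>
    (congrArg (show C →ₗ[S] N from f) (add_smul (op r) (op s) c)).trans
      (map_add (show C →ₗ[S] N from f) _ _)
  zero_smul f := LinearMap.ext fun c =>
    (congrArg (show C →ₗ[S] N from f) (zero_smul Rᵐᵒᵖ c)).trans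
      (map_zero (show C →ₗ[S] N from f))

end Hom

section Tor

variable {R : Type u} [Ring R]

/-- The map `f ⊗_R M` induced by a homomorphism `f` of right `R`-modules. -/
def balancedTensorMap {F G : Type*} [AddCommGroup F] [Module Rᵐᵒᵖ F] [AddCommGroup G]
    [Module Rᵐᵒᵖ G] (M : Type*) [AddCommGroup M] [Module R M] (f : F →ₗ[Rᵐᵒᵖ] G) :
    BalancedTensor ℤ R F M →ₗ[ℤ] BalancedTensor ℤ R G M :=
  Submodule.mapQ _ _ (TensorProduct.AlgebraTensorModule.map f.toAddMonoidHom.toIntLinearMap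
      (LinearMap.id : M →ₗ[ℤ] M)) <| by
    refine Submodule.span_le.2 ?_
    rintro _ ⟨c, r, m, rfl⟩
    refine Submodule.subset_span ⟨f c, r, m, ?_⟩
    simp

theorem balancedTensor_hom_ext {F M P : Type*} [AddCommGroup F] [Module Rᵐᵒᵖ F] [AddCommGroup M]
    [Module R M] [AddCommGroup P] {f g : BalancedTensor ℤ R F M →ₗ[ℤ] P}
    (h : ∀ x y, f (Submodule.Quotient.mk (x ⊗ₜ y)) = g (Submodule.Quotient.mk (x ⊗ₜ y))) :
    f = g := by
  refine LinearMap.ext fun t => ?_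
  obtain ⟨t, rfl⟩ := Submodule.Quotient.mk_surjective _ t
  induction t using TensorProduct.induction_on with
  | zero => rw [Submodule.Quotient.mk_zero, map_zero, map_zero]
  | tmul x y => exact h x y
  | add x y hx hy => rw [Submodule.Quotient.mk_add, map_add, map_add, hx, hy]

/-- The functor `- ⊗_R M` from right `R`-modules to abelian groups. -/
def rightTensorFunctor (M : ModuleCat.{u} R) : ModuleCat.{u} Rᵐᵒᵖ ⥤ ModuleCat.{u} ℤ where
  obj F := ModuleCat.of ℤ (BalancedTensor ℤ R F M)
  map f := ModuleCat.ofHom (balancedTensorMap M f.hom)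
  map_id _ := ModuleCat.hom_ext (balancedTensor_hom_ext fun _ _ => rfl)
  map_comp _ _ := ModuleCat.hom_ext (balancedTensor_hom_ext fun _ _ => rfl)

instance (M : ModuleCat.{u} R) : (rightTensorFunctor M).Additive where
  map_add {_ G f g} := ModuleCat.hom_ext (balancedTensor_hom_ext fun x y =>
    congrArg (Submodule.Quotient.mk (p := balancedRel ℤ R G M))
      (TensorProduct.add_tmul (f.hom x) (g.hom x) y))

/-- `Tor_n^R(F, M)` for a right `R`-module `F` and a left `R`-module `M`: the `n`-th left derived
functor of `- ⊗_R M`, evaluated at `F`. -/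
def RingTor (n : ℕ) (F : ModuleCat.{u} Rᵐᵒᵖ) (M : ModuleCat.{u} R) : ModuleCat.{u} ℤ :=
  ((rightTensorFunctor M).leftDerived n).obj F

/-- `M` is super finitely presented: it has a projective resolution by finitely generated
projective modules. -/
def IsSuperFinitelyPresented (M : ModuleCat.{u} R) : Prop :=
  ∃ P : ProjectiveResolution M, ∀ n, Module.Finite R (P.complex.X n)

/-- `M` is weak injective: `Ext¹_R(F, M) = 0` for all super finitely presented `F`. -/
def IsWeakInjective (M : ModuleCat.{u} R) : Prop :=
  ∀ F : ModuleCat.{u} R, IsSuperFinitelyPresented F → Subsingleton (Abelian.Ext.{u} F M 1)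

/-- The left `R`-module `M` is weak flat: `Tor_1^R(F, M) = 0` for all super finitely presented
right `R`-modules `F`. -/
def IsWeakFlat (M : ModuleCat.{u} R) : Prop :=
  ∀ F : ModuleCat.{u} Rᵐᵒᵖ, IsSuperFinitelyPresented F → Subsingleton (RingTor 1 F M)

/-- The weak injective dimension `wid_R(M)`; it is `⊤` if there is no `n` as required. -/
def weakInjectiveDim (M : ModuleCat.{u} R) : ℕ∞ :=
  ⨅ (n : ℕ) (_ : ∀ F : ModuleCat.{u} R, IsSuperFinitelyPresented F →
    Subsingleton (Abelian.Ext.{u} F M (n + 1))), (n : ℕ∞)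

/-- The weak flat dimension `wfd_R(M)`; it is `⊤` if there is no `n` as required. -/
def weakFlatDim (M : ModuleCat.{u} R) : ℕ∞ :=
  ⨅ (n : ℕ) (_ : ∀ F : ModuleCat.{u} Rᵐᵒᵖ, IsSuperFinitelyPresented F →
    Subsingleton (RingTor (n + 1) F M)), (n : ℕ∞)

end Tor

section Bimodule

variable (S R C : Type u) [Ring S] [Ring R] [AddCommGroup C] [Module S C] [Module Rᵐᵒᵖ C]
  [SMulCommClass S Rᵐᵒᵖ C]

/-- `C` is a semidualizing `(S, R)`-bimodule. -/
structure IsSemidualizing : Prop where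
  finite_left : IsSuperFinitelyPresented (ModuleCat.of S C)
  finite_right : IsSuperFinitelyPresented (ModuleCat.of Rᵐᵒᵖ C)
  /-- The homothety map `S → Hom_{Rᵒᵖ}(C, C)`, `s ↦ (c ↦ s c)`, is an isomorphism. -/
  homothety_left : Function.Bijective (fun s : S => (leftHomothety C s : C →ₗ[Rᵐᵒᵖ] C))
  /-- The homothety map `R → Hom_S(C, C)`, `r ↦ (c ↦ c r)`, is an isomorphism. -/
  homothety_right : Function.Bijective (fun r : R => (rightHomothety C r : C →ₗ[S] C))
  ext_left : ∀ i : ℕ, 1 ≤ i →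
    Subsingleton (Abelian.Ext.{u} (ModuleCat.of S C) (ModuleCat.of S C) i)
  ext_right : ∀ i : ℕ, 1 ≤ i →
    Subsingleton (Abelian.Ext.{u} (ModuleCat.of Rᵐᵒᵖ C) (ModuleCat.of Rᵐᵒᵖ C) i)

/-- `C` is a faithfully semidualizing `(S, R)`-bimodule. -/
structure IsFaithfullySemidualizing : Prop extends IsSemidualizing S R C where
  faithful_left : ∀ N : ModuleCat.{u} S, Subsingleton (C →ₗ[S] N) → Subsingleton N
  faithful_right : ∀ N : ModuleCat.{u} Rᵐᵒᵖ, Subsingleton (C →ₗ[Rᵐᵒᵖ] N) → Subsingleton N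

variable {R} in
/-- The left `S`-module `C ⊗_R M`. -/
abbrev foxbyTensor (M : ModuleCat.{u} R) : ModuleCat.{u} S :=
  ModuleCat.of S (BalancedTensor S R C M)

variable {S} in
/-- The left `R`-module `Hom_S(C, N)`. -/
abbrev foxbyHom (N : ModuleCat.{u} S) : ModuleCat.{u} R :=
  ModuleCat.of R (BimodHom S R C N)

/-- There is an exact sequence `0 → C ⊗_R F_n → ⋯ → C ⊗_R F_0 → M → 0` of left `S`-modules with
all `F_i` weak flat. The sequence is continued by `F_i = 0` for `i > n`. -/
def HasCWeakFlatResolution (n : ℕ) (M : ModuleCat.{u} S) : Prop :=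
  ∃ (F : ℕ → ModuleCat.{u} R)
    (d : ∀ i, foxbyTensor S C (F (i + 1)) →ₗ[S] foxbyTensor S C (F i))
    (ε : foxbyTensor S C (F 0) →ₗ[S] M),
    (∀ i ≤ n, IsWeakFlat (F i)) ∧ (∀ i, n < i → Subsingleton (F i)) ∧
    Function.Surjective ε ∧ Function.Exact (d 0) ε ∧ ∀ i, Function.Exact (d (i + 1)) (d i)

/-- There is an exact sequence `0 → M → Hom_S(C, I^0) → ⋯ → Hom_S(C, I^n) → 0` of left `R`-modules
with all `I^i` weak injective. The sequence is continued by `I^i = 0` for `i > n`. -/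
def HasCWeakInjectiveCoresolution (n : ℕ) (M : ModuleCat.{u} R) : Prop :=
  ∃ (I : ℕ → ModuleCat.{u} S)
    (η : M →ₗ[R] foxbyHom R C (I 0))
    (d : ∀ i, foxbyHom R C (I i) →ₗ[R] foxbyHom R C (I (i + 1))),
    (∀ i ≤ n, IsWeakInjective (I i)) ∧ (∀ i, n < i → Subsingleton (I i)) ∧
    Function.Injective η ∧ Function.Exact η (d 0) ∧ ∀ i, Function.Exact (d i) (d (i + 1))

/-- The `C`-weak flat dimension `C-wfd_S(M)`. -/
def cWeakFlatDim (M : ModuleCat.{u} S) : ℕ∞ :=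
  ⨅ (n : ℕ) (_ : HasCWeakFlatResolution S R C n M), (n : ℕ∞)

/-- The `C`-weak injective dimension `C-wid_R(M)`. -/
def cWeakInjectiveDim (M : ModuleCat.{u} R) : ℕ∞ :=
  ⨅ (n : ℕ) (_ : HasCWeakInjectiveCoresolution S R C n M), (n : ℕ∞)

end Bimodule

end

/-! The four equalities are instances of Foxby equivalence. The functors `C ⊗_R -` and `Hom_S(C, -)`
are mutually inverse, up to unit and counit, between the Auslander class of left `R`-modules
(`InAuslander`) and the Bass class of left `S`-modules (`InBass`), and they preserve short exact
sequences inside these classes. Resolutions can therefore be carried across: `N` has a `C`-weak flat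
resolution of length `n` exactly when `N` is in the Bass class and `wfd_R(Hom_S(C, N)) ≤ n`
(`hasCWeakFlatResolution_iff`), and dually for coresolutions (`hasCWeakInjectiveCoresolution_iff`).

The class conditions turn out to be automatic. Modules of finite weak flat dimension are in the
Auslander class and modules of finite weak injective dimension are in the Bass class
(`InAuslander.of_weakFlatDimLE`, `InBass.of_weakInjDimLE`). By faithfulness, `M` is in the Auslander
class as soon as `C ⊗_R M` is in the Bass class, and conversely with `Hom_S(C, -)`
(`InBass.inAuslander_of_tensor`, `InAuslander.inBass_of_hom`). Faithfulness also supplies the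
closure properties under cokernels and kernels that semidualizing alone does not give.

The case of dimension zero rests on evaluation maps. For weak flat `M`, the map `Hom_S(K, C) ⊗_R M →
Hom_S(K, C ⊗_R M)` is bijective not only for `K = C` but for every `K` that is super finitely
presented, has no higher `Ext` into `C` and has a super finitely presented dual (`IsDualizable`).
This class is closed under syzygies, so that one comparison with a free presentation gives both
bijectivity and the vanishing of `Ext`. For weak injective `N` the map `K ⊗_R Hom_S(C, N) →
Hom_S(Hom(K, C), N)` plays the same role.

Throughout, `Tor` is replaced by `Ext` through the duality between `Tor_i(F, M)` and `Ext^i(F,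
Hom_ℤ(M, ℚ/ℤ))`, and weak flat dimension becomes weak injective dimension of the character module.
-/

/-! ### Vanishing of `Ext` along short exact sequences -/

noncomputable section ExtVanishing

variable {A : Type u} [Ring A] {K L X Y Z N : Type u}
  [AddCommGroup K] [AddCommGroup L] [AddCommGroup X] [AddCommGroup Y] [AddCommGroup Z]
  [AddCommGroup N] [Module A K] [Module A L] [Module A X] [Module A Y] [Module A Z] [Module A N]

variable (A K N) in
/-- `Ext_A^n(K, N) = 0`. -/
def ExtZero (n : ℕ) : Prop :=
  Subsingleton (Abelian.Ext.{u} (ModuleCat.of A K) (ModuleCat.of A N) n)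

/-- `0 → X → Y → Z → 0` is exact. -/
structure IsShortExact (f : X →ₗ[A] Y) (g : Y →ₗ[A] Z) : Prop where
  injective : Function.Injective f
  exact : Function.Exact f g
  surjective : Function.Surjective g

theorem IsShortExact.ker {g : Y →ₗ[A] Z} (hg : Function.Surjective g) :
    IsShortExact (LinearMap.ker g).subtype g :=
  ⟨Subtype.val_injective, LinearMap.exact_subtype_ker_map g, hg⟩

theorem IsShortExact.quotient {f : X →ₗ[A] Y} (hf : Function.Injective f) :
    IsShortExact f (LinearMap.range f).mkQ :=
  ⟨hf, LinearMap.exact_map_mkQ_range f, Submodule.mkQ_surjective _⟩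

variable {f : X →ₗ[A] Y} {g : Y →ₗ[A] Z}

theorem IsShortExact.comp_eq_zero (h : IsShortExact f g) : g ∘ₗ f = 0 :=
  h.exact.linearMap_comp_eq_zero

theorem IsShortExact.exists_desc {f : X →ₗ[A] Y} {g : Y →ₗ[A] Z} (h : IsShortExact f g)
    {P : Type*} [AddCommGroup P] [Module A P] (k : Y →ₗ[A] P) (hk : k ∘ₗ f = 0) :
    ∃ l : Z →ₗ[A] P, l ∘ₗ g = k := by
  have hle : LinearMap.ker g ≤ LinearMap.ker k := fun y hy => by
    obtain ⟨x, rfl⟩ := (h.exact y).1 hy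
    exact LinearMap.congr_fun hk x
  refine ⟨(LinearMap.ker g).liftQ k hle ∘ₗ
    (g.quotKerEquivOfSurjective h.surjective).symm.toLinearMap, LinearMap.ext fun y => ?_⟩
  have : (g.quotKerEquivOfSurjective h.surjective).symm (g y) = (LinearMap.ker g).mkQ y :=
    (LinearEquiv.symm_apply_eq _).2 rfl
  rw [LinearMap.comp_apply, LinearMap.comp_apply, LinearEquiv.coe_coe, this]
  rfl

/-- The bundled short complex. -/
abbrev IsShortExact.complex (h : IsShortExact f g) : ShortComplex (ModuleCat.{u} A) :=
  ShortComplex.mk (ModuleCat.ofHom f) (ModuleCat.ofHom g)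
    (by rw [← ModuleCat.ofHom_comp, h.comp_eq_zero]; rfl)

theorem IsShortExact.shortExact (h : IsShortExact f g) : h.complex.ShortExact where
  exact := (ShortComplex.ShortExact.moduleCat_exact_iff_function_exact _).2 h.exact
  mono_f := (ModuleCat.mono_iff_injective _).2 h.injective
  epi_g := (ModuleCat.epi_iff_surjective _).2 h.surjective

open Abelian

theorem ExtZero.covariant₁ (h : IsShortExact f g) {n : ℕ} (hZ : ExtZero A K Z n)
    (hY : ExtZero A K Y (n + 1)) : ExtZero A K X (n + 1) := by
  refine subsingleton_of_forall_eq 0 fun x => ?_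
  obtain ⟨y, rfl⟩ := Ext.covariant_sequence_exact₁ _ h.shortExact x (hY.elim _ _) rfl
  rw [hZ.elim y 0, Ext.zero_comp]

theorem ExtZero.covariant₃ (h : IsShortExact f g) {n : ℕ} (hY : ExtZero A K Y n)
    (hX : ExtZero A K X (n + 1)) : ExtZero A K Z n := by
  refine subsingleton_of_forall_eq 0 fun x => ?_
  obtain ⟨y, rfl⟩ := Ext.covariant_sequence_exact₃ _ h.shortExact x rfl (hX.elim _ _)
  rw [hY.elim y 0, Ext.zero_comp]

theorem ExtZero.contravariant₁ (h : IsShortExact f g) {n : ℕ} (hY : ExtZero A Y N n)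
    (hZ : ExtZero A Z N (n + 1)) : ExtZero A X N n := by
  refine subsingleton_of_forall_eq 0 fun x => ?_
  obtain ⟨y, rfl⟩ := Ext.contravariant_sequence_exact₁ h.shortExact _ x (add_comm 1 n)
    (hZ.elim _ _)
  rw [hY.elim y 0, Ext.comp_zero]

theorem ExtZero.contravariant₃ (h : IsShortExact f g) {n : ℕ} (hX : ExtZero A X N n)
    (hY : ExtZero A Y N (n + 1)) : ExtZero A Z N (n + 1) := by
  refine subsingleton_of_forall_eq 0 fun x => ?_
  obtain ⟨y, rfl⟩ := Ext.contravariant_sequence_exact₃ h.shortExact _ x (hY.elim _ _)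
    (add_comm 1 n)
  rw [hX.elim y 0, Ext.comp_zero]

theorem ExtZero.exists_lift (h : IsShortExact f g) (hX : ExtZero A K X 1) (k : K →ₗ[A] Z) :
    ∃ l : K →ₗ[A] Y, g ∘ₗ l = k := by
  obtain ⟨y, hy⟩ := Ext.covariant_sequence_exact₃ _ h.shortExact
    (Ext.mk₀ (ModuleCat.ofHom k)) (zero_add 1) (hX.elim _ _)
  obtain ⟨l, rfl⟩ := (Ext.mk₀_bijective _ _).2 y
  rw [Ext.mk₀_comp_mk₀] at hy
  exact ⟨l.hom, congrArg ModuleCat.Hom.hom ((Ext.mk₀_bijective _ _).1 hy)⟩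

theorem ExtZero.exists_extension (h : IsShortExact f g) (hZ : ExtZero A Z N 1) (k : X →ₗ[A] N) :
    ∃ l : Y →ₗ[A] N, l ∘ₗ f = k := by
  obtain ⟨y, hy⟩ := Ext.contravariant_sequence_exact₁ h.shortExact _
    (Ext.mk₀ (ModuleCat.ofHom k)) (add_zero 1) (hZ.elim _ _)
  obtain ⟨l, rfl⟩ := (Ext.mk₀_bijective _ _).2 y
  rw [Ext.mk₀_comp_mk₀] at hy
  exact ⟨l.hom, congrArg ModuleCat.Hom.hom ((Ext.mk₀_bijective _ _).1 hy)⟩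

/-- The connecting map `Hom(K, Z) → Ext¹(K, X)` is onto because `Ext¹(K, Y) = 0`, and it kills every
map that lifts to `Y`. -/
theorem ExtZero.one_of_forall_lift (h : IsShortExact f g) (hY : ExtZero A K Y 1)
    (H : ∀ k : K →ₗ[A] Z, ∃ l : K →ₗ[A] Y, g ∘ₗ l = k) : ExtZero A K X 1 := by
  refine subsingleton_of_forall_eq 0 fun x => ?_
  obtain ⟨y, rfl⟩ := Ext.covariant_sequence_exact₁ _ h.shortExact x (hY.elim _ _) (zero_add 1)
  obtain ⟨k, rfl⟩ := (Ext.mk₀_bijective _ _).2 y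
  obtain ⟨l, hl⟩ := H k.hom
  have : k = ModuleCat.ofHom l ≫ h.complex.g := ModuleCat.hom_ext hl.symm
  rw [this, ← Ext.mk₀_comp_mk₀, Ext.comp_assoc_of_second_deg_zero,
    h.shortExact.comp_extClass, Ext.comp_zero]

theorem ExtZero.one_of_forall_extension (h : IsShortExact f g) (hY : ExtZero A Y N 1)
    (H : ∀ k : X →ₗ[A] N, ∃ l : Y →ₗ[A] N, l ∘ₗ f = k) : ExtZero A Z N 1 := by
  refine subsingleton_of_forall_eq 0 fun x => ?_
  obtain ⟨y, rfl⟩ := Ext.contravariant_sequence_exact₃ h.shortExact _ x (hY.elim _ _) (add_zero 1)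
  obtain ⟨k, rfl⟩ := (Ext.mk₀_bijective _ _).2 y
  obtain ⟨l, hl⟩ := H k.hom
  have : k = h.complex.f ≫ ModuleCat.ofHom l := ModuleCat.hom_ext hl.symm
  rw [this, ← Ext.mk₀_comp_mk₀, h.shortExact.extClass_comp_assoc]

theorem ExtZero.of_projective [Module.Projective A K] (n : ℕ) : ExtZero A K N (n + 1) :=
  have : Projective (ModuleCat.of A K) := inferInstance
  Ext.subsingleton_of_projective _ _ _

theorem ExtZero.of_injective [Injective (ModuleCat.of A N)] (n : ℕ) : ExtZero A K N (n + 1) :=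
  Ext.subsingleton_of_injective _ _ _

theorem ExtZero.congr_right (e : Y ≃ₗ[A] N) {n : ℕ} (h : ExtZero A K Y n) : ExtZero A K N n := by
  refine subsingleton_of_forall_eq 0 fun x => ?_
  have : (x.comp (Ext.mk₀ e.toModuleIso.inv) (add_zero n)).comp (Ext.mk₀ e.toModuleIso.hom)
      (add_zero n) = x := by
    simp only [Ext.comp_assoc_of_third_deg_zero, Ext.mk₀_comp_mk₀, Iso.inv_hom_id, Ext.comp_mk₀_id]
  rw [← this, h.elim (x.comp (Ext.mk₀ e.toModuleIso.inv) (add_zero n)) 0, Ext.zero_comp]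

end ExtVanishing

/-! ### Super finitely presented modules -/

noncomputable section SuperFinitelyPresented

variable {A : Type u} [Ring A]

/-- There is an exact sequence `⋯ → Q 1 → Q 0 → M → 0` with all `Q n` finitely generated
projective. -/
def HasFiniteProjectiveSequence (M : ModuleCat.{u} A) : Prop :=
  ∃ (Q : ℕ → ModuleCat.{u} A) (d : ∀ n, Q (n + 1) →ₗ[A] Q n) (ε : Q 0 →ₗ[A] M),
    (∀ n, Module.Finite A (Q n) ∧ Module.Projective A (Q n)) ∧ Function.Surjective ε ∧
    Function.Exact (d 0) ε ∧ ∀ n, Function.Exact (d (n + 1)) (d n)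

theorem HasFiniteProjectiveSequence.isSuperFinitelyPresented {M : ModuleCat.{u} A}
    (h : HasFiniteProjectiveSequence M) : IsSuperFinitelyPresented M := by
  obtain ⟨Q, d, ε, hQ, hε, h₀, hd⟩ := h
  have hproj (n) : Projective (Q n) := by
    have := (hQ n).2
    have : Projective (ModuleCat.of A (Q n)) := inferInstance
    exact this
  let K : ChainComplex (ModuleCat.{u} A) ℕ :=
    ChainComplex.of Q (fun n => ModuleCat.ofHom (d n)) fun n => by
      rw [← ModuleCat.ofHom_comp, (hd n).linearMap_comp_eq_zero]; rfl
  have hK (n) : K.d (n + 1) n = ModuleCat.ofHom (d n) :=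
    ChainComplex.of_d Q (fun n => ModuleCat.ofHom (d n)) n
  let π : K ⟶ (ChainComplex.single₀ _).obj M :=
    (ChainComplex.toSingle₀Equiv _ _).symm ⟨ModuleCat.ofHom ε, by
      rw [hK]
      exact (ModuleCat.ofHom_comp _ _).symm.trans
        (congrArg ModuleCat.ofHom h₀.linearMap_comp_eq_zero)⟩
  -- In degree zero this says that `Q 1 → Q 0 → M → 0` is exact; in higher degrees, that the complex
  -- `Q` is exact there.
  have hπ : QuasiIso π := ⟨fun n => by
    cases n with
    | zero =>
      rw [ChainComplex.quasiIsoAt₀_iff, ShortComplex.quasiIso_iff_of_zeros']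
      · refine (ShortComplex.exact_and_epi_g_iff_of_iso
          (S₂ := ShortComplex.mk (ModuleCat.ofHom (d 0)) (ModuleCat.ofHom ε) ?_) ?_).2 ⟨?_, ?_⟩
        · exact (ModuleCat.ofHom_comp _ _).symm.trans
            (congrArg ModuleCat.ofHom h₀.linearMap_comp_eq_zero)
        · exact ShortComplex.isoMk (Iso.refl _) (Iso.refl _) (Iso.refl _)
            ((Category.id_comp _).trans ((hK 0).symm.trans (Category.comp_id _).symm))
            ((Category.id_comp _).trans
              ((show π.f 0 = ModuleCat.ofHom ε by simp [π]).symm.trans (Category.comp_id _).symm))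
        · exact (ShortComplex.ShortExact.moduleCat_exact_iff_function_exact _).2 h₀
        · exact (ModuleCat.epi_iff_surjective _).2 hε
      all_goals rfl
    | succ n =>
      rw [quasiIsoAt_iff_exactAt']
      · rw [HomologicalComplex.exactAt_iff' _ (n + 1 + 1) (n + 1) n (by simp) (by simp),
          ShortComplex.ShortExact.moduleCat_exact_iff_function_exact]
        change Function.Exact (K.d (n + 2) (n + 1)).hom (K.d (n + 1) n).hom
        rw [hK, hK]
        exact hd n
      · apply ChainComplex.exactAt_succ_single_obj⟩
  exact ⟨{ complex := K, π := π, projective := hproj, quasiIso := hπ }, fun n => (hQ n).1⟩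

theorem IsSuperFinitelyPresented.hasFiniteProjectiveSequence {M : ModuleCat.{u} A}
    (h : IsSuperFinitelyPresented M) : HasFiniteProjectiveSequence M := by
  obtain ⟨P, hP⟩ := h
  refine ⟨P.complex.X, fun n => (P.complex.d (n + 1) n).hom, (P.π.f 0).hom,
    fun n => ⟨hP n, ?_⟩, ?_, ?_, fun n => ?_⟩
  · have := P.projective n
    exact (IsProjective.iff_projective _).2 this
  · exact (ModuleCat.epi_iff_surjective _).1 inferInstance
  · exact (ShortComplex.ShortExact.moduleCat_exact_iff_function_exact _).1 P.exact₀
  · exact (ShortComplex.ShortExact.moduleCat_exact_iff_function_exact _).1 (P.exact_succ n)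

/-- The modules obtained by iterating the kernels of given maps `g N : Q N → N`. -/
def iteratedKernel (Q : ModuleCat.{u} A → ModuleCat.{u} A) (g : ∀ N, Q N →ₗ[A] N)
    (M : ModuleCat.{u} A) : ℕ → ModuleCat.{u} A
  | 0 => M
  | n + 1 => ModuleCat.of A (LinearMap.ker (g (iteratedKernel Q g M n)))

/-- A class of modules, each of which is the quotient of a finitely generated projective module by
a module of the class, consists of super finitely presented modules. -/
theorem IsSuperFinitelyPresented.coinduction (p : ModuleCat.{u} A → Prop)
    (hp : ∀ M, p M → ∃ (Q : ModuleCat.{u} A) (g : Q →ₗ[A] M), Module.Finite A Q ∧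
      Module.Projective A Q ∧ Function.Surjective g ∧ p (ModuleCat.of A (LinearMap.ker g)))
    {M : ModuleCat.{u} A} (hM : p M) : IsSuperFinitelyPresented M := by
  choose! Q g hfin hproj hsurj hker using hp
  have hX : ∀ n, p (iteratedKernel Q g M n) := fun n => by
    induction n with
    | zero => exact hM
    | succ n ih => exact hker _ ih
  -- Each kernel is covered by the next projective; following the cover by the inclusion of the
  -- kernel gives the differentials.
  let G (n : ℕ) : Q (iteratedKernel Q g M (n + 1)) →ₗ[A]
      LinearMap.ker (g (iteratedKernel Q g M n)) := g (iteratedKernel Q g M (n + 1))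
  have hG (n) : Function.Surjective (G n) := hsurj _ (hX (n + 1))
  refine HasFiniteProjectiveSequence.isSuperFinitelyPresented
    ⟨fun n => Q (iteratedKernel Q g M n), fun n => Submodule.subtype _ ∘ₗ G n, g M,
      fun n => ⟨hfin _ (hX n), hproj _ (hX n)⟩, hsurj _ hM, ?_, fun n => ?_⟩
  · exact fun y => ⟨fun hy => by
      obtain ⟨x, hx⟩ := hG 0 ⟨y, hy⟩
      exact ⟨x, congrArg Subtype.val hx⟩, by
      rintro ⟨x, rfl⟩
      exact (G 0 x).2⟩
  · exact fun y => ⟨fun hy => by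
      obtain ⟨x, hx⟩ := hG (n + 1) ⟨y, Subtype.ext hy⟩
      exact ⟨x, congrArg Subtype.val hx⟩, by
      rintro ⟨x, rfl⟩
      exact congrArg Subtype.val (G (n + 1) x).2⟩

variable (A) in
/-- Super finite presentation of an unbundled module. -/
def SuperFP (M : Type u) [AddCommGroup M] [Module A M] : Prop :=
  IsSuperFinitelyPresented (ModuleCat.of A M)

variable {M N K X Y Z : Type u} [AddCommGroup M] [Module A M] [AddCommGroup N] [Module A N]
  [AddCommGroup K] [Module A K]
  [AddCommGroup X] [Module A X] [AddCommGroup Y] [Module A Y] [AddCommGroup Z] [Module A Z]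

theorem SuperFP.congr (h : SuperFP A M) (e : M ≃ₗ[A] N) : SuperFP A N := by
  obtain ⟨Q, d, ε, hQ, hε, h₀, hd⟩ := h.hasFiniteProjectiveSequence
  refine HasFiniteProjectiveSequence.isSuperFinitelyPresented
    ⟨Q, d, e.toLinearMap ∘ₗ ε, hQ, e.surjective.comp hε, fun y => ?_, hd⟩
  rw [← h₀ y]
  exact e.map_eq_zero_iff

theorem SuperFP.exists_presentation (h : SuperFP A M) :
    ∃ (Q : ModuleCat.{u} A) (g : Q →ₗ[A] M), Module.Finite A Q ∧ Module.Projective A Q ∧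
      Function.Surjective g ∧ SuperFP A (LinearMap.ker g) := by
  obtain ⟨Q, d, ε, hQ, hε, h₀, hd⟩ := h.hasFiniteProjectiveSequence
  refine ⟨Q 0, ε, (hQ 0).1, (hQ 0).2, hε, HasFiniteProjectiveSequence.isSuperFinitelyPresented
    ⟨fun n => Q (n + 1), fun n => d (n + 1),
      (d 0).codRestrict _ fun x => h₀.apply_apply_eq_zero x, fun n => hQ (n + 1), ?_, ?_,
      fun n => hd (n + 1)⟩⟩
  · rintro ⟨y, hy⟩
    obtain ⟨x, rfl⟩ := (h₀ y).1 hy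
    exact ⟨x, rfl⟩
  · intro y
    rw [← hd 0 y]
    exact Subtype.ext_iff

theorem SuperFP.of_presentation {Q : Type u} [AddCommGroup Q] [Module A Q] [Module.Finite A Q]
    [Module.Projective A Q] {g : Q →ₗ[A] M} (hg : Function.Surjective g)
    (h : SuperFP A (LinearMap.ker g)) : SuperFP A M := by
  -- Adjoining the single module `M` to the class of super finitely presented modules keeps the
  -- class closed under taking syzygies.
  refine IsSuperFinitelyPresented.coinduction
    (fun N => IsSuperFinitelyPresented N ∨ N = ModuleCat.of A M) ?_ (Or.inr rfl)
  rintro N (hN | rfl)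
  · obtain ⟨Q, g, h₁, h₂, h₃, h₄⟩ := SuperFP.exists_presentation (M := N) hN
    exact ⟨Q, g, h₁, h₂, h₃, Or.inl h₄⟩
  · exact ⟨ModuleCat.of A Q, g, inferInstance, inferInstance, hg, Or.inl h⟩

theorem SuperFP.of_finite_projective [Module.Finite A M] [Module.Projective A M] :
    SuperFP A M := by
  refine IsSuperFinitelyPresented.coinduction
    (fun N => Module.Finite A N ∧ Module.Projective A N)
    (fun N hN => ⟨N, LinearMap.id, hN.1, hN.2, Function.surjective_id, ?_⟩)
    ⟨‹_›, ‹_›⟩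
  have : Subsingleton (LinearMap.ker (LinearMap.id : N →ₗ[A] N)) :=
    ⟨fun x y => Subtype.ext (x.2.trans y.2.symm)⟩
  exact ⟨inferInstance, inferInstance⟩

end SuperFinitelyPresented

/-! ### Closure of super finite presentation under extensions, cokernels and syzygies -/

noncomputable section SuperFPClosure

variable {A : Type u} [Ring A]
variable {M X Y Z : Type u} [AddCommGroup M] [Module A M]
  [AddCommGroup X] [Module A X] [AddCommGroup Y] [Module A Y] [AddCommGroup Z] [Module A Z]

/-- The kernel of the map `Q₁ × Q₂ → Y` of the horseshoe lemma is an extension of the two kernels. -/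
theorem IsShortExact.ker_coprod {Q₁ Q₂ : Type u} [AddCommGroup Q₁] [Module A Q₁] [AddCommGroup Q₂]
    [Module A Q₂] {f : X →ₗ[A] Y} {g : Y →ₗ[A] Z} (h : IsShortExact f g) {a : Q₁ →ₗ[A] X}
    {b : Q₂ →ₗ[A] Y} (ha : Function.Surjective a) :
    ∃ (i : LinearMap.ker a →ₗ[A] LinearMap.ker ((f ∘ₗ a).coprod b))
      (p : LinearMap.ker ((f ∘ₗ a).coprod b) →ₗ[A] LinearMap.ker (g ∘ₗ b)), IsShortExact i p := by
  have hgf (x) : g (f x) = 0 := h.exact.apply_apply_eq_zero x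
  refine ⟨(LinearMap.inl A Q₁ Q₂ ∘ₗ (LinearMap.ker a).subtype).codRestrict _ ?_,
    (LinearMap.snd A Q₁ Q₂ ∘ₗ Submodule.subtype _).codRestrict _ ?_, ?_, ?_, ?_⟩
  · rintro ⟨x, hx⟩
    simp [LinearMap.mem_ker.1 hx]
  · rintro ⟨⟨x, y⟩, hx⟩
    have := congrArg g (LinearMap.mem_ker.1 hx)
    simpa [hgf] using this
  · rintro ⟨x, hx⟩ ⟨y, hy⟩ hxy
    simpa [Subtype.ext_iff] using hxy
  · rintro ⟨⟨x, y⟩, hx⟩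
    constructor
    · intro hy
      have hy : y = 0 := congrArg Subtype.val hy
      subst hy
      have hx : f (a x) = 0 := by simpa using hx
      refine ⟨⟨x, h.injective (hx.trans (map_zero f).symm)⟩, rfl⟩
    · rintro ⟨z, hz⟩
      rw [← hz]
      rfl
  · rintro ⟨y, hy⟩
    obtain ⟨x, hx⟩ := (h.exact (b y)).1 hy
    obtain ⟨q, rfl⟩ := ha x
    -- Since `f (a q) = b y`, the sign puts the pair in the kernel of the sum map.
    exact ⟨⟨(-q, y), by simp [hx]⟩, rfl⟩

/-- The horseshoe lemma in coinductive form: a syzygy of an extension is again an extension, of the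
syzygies of the two ends. -/
theorem SuperFP.of_extension {f : X →ₗ[A] Y} {g : Y →ₗ[A] Z} (h : IsShortExact f g)
    (hX : SuperFP A X) (hZ : SuperFP A Z) : SuperFP A Y := by
  refine IsSuperFinitelyPresented.coinduction (M := ModuleCat.of A Y)
    (fun Y => ∃ (X Z : ModuleCat.{u} A) (f : X →ₗ[A] Y) (g : Y →ₗ[A] Z), IsShortExact f g ∧
      SuperFP A X ∧ SuperFP A Z) ?_ ⟨ModuleCat.of A X, ModuleCat.of A Z, f, g, h, hX, hZ⟩
  clear! X Y Z
  rintro Y ⟨X, Z, f, g, h, hX, hZ⟩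
  obtain ⟨Q₁, a, _, _, ha, hka⟩ := hX.exists_presentation
  obtain ⟨Q₂, c, _, _, hc, hkc⟩ := hZ.exists_presentation
  obtain ⟨b, rfl⟩ := Module.projective_lifting_property g c h.surjective
  obtain ⟨i, p, hip⟩ := h.ker_coprod (b := b) ha
  refine ⟨ModuleCat.of A (Q₁ × Q₂), (f ∘ₗ a).coprod b, inferInstance, inferInstance, fun y => ?_,
    ModuleCat.of A (LinearMap.ker a), ModuleCat.of A (LinearMap.ker (g ∘ₗ b)), i, p, hip, hka, hkc⟩
  obtain ⟨q₂, hq₂⟩ := hc (g y)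
  obtain ⟨x, hx⟩ := (h.exact (y - b q₂)).1 (by rw [map_sub, ← hq₂]; exact sub_self _)
  obtain ⟨q₁, rfl⟩ := ha x
  exact ⟨(q₁, q₂), by simp [hx]⟩

/-- A projective cover `p` of `Y` also maps onto `Z`, and the kernel of `Q → Z` is an extension of
`range f ≅ X` by `ker p`. -/
theorem SuperFP.of_cokernel {f : X →ₗ[A] Y} {g : Y →ₗ[A] Z} (h : IsShortExact f g)
    (hX : SuperFP A X) (hY : SuperFP A Y) : SuperFP A Z := by
  obtain ⟨Q, p, _, _, hp, hkp⟩ := hY.exists_presentation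
  refine SuperFP.of_presentation (g := g ∘ₗ p) (h.surjective.comp hp) ?_
  have hmem (q : LinearMap.ker (g ∘ₗ p)) : p q ∈ LinearMap.range f := (h.exact _).1 q.2
  let i : LinearMap.ker p →ₗ[A] LinearMap.ker (g ∘ₗ p) :=
    Submodule.inclusion (LinearMap.ker_le_ker_comp p g)
  let r : LinearMap.ker (g ∘ₗ p) →ₗ[A] LinearMap.range f :=
    (p ∘ₗ Submodule.subtype _).codRestrict _ hmem
  have hir : IsShortExact i r := by
    refine ⟨Submodule.inclusion_injective _, ?_, ?_⟩
    · intro y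
      rw [Subtype.ext_iff]
      exact ⟨fun hy => ⟨⟨y, hy⟩, rfl⟩, by rintro ⟨x, rfl⟩; exact x.2⟩
    · rintro ⟨_, x, rfl⟩
      obtain ⟨q, hq⟩ := hp (f x)
      exact ⟨⟨q, by simpa [hq] using h.exact.apply_apply_eq_zero x⟩, Subtype.ext hq⟩
  exact hkp.of_extension hir (hX.congr (LinearEquiv.ofInjective f h.injective))

/-- Schanuel's argument: the defining presentation has some good syzygy `ker a`, and any other
finitely generated projective presentation has to be compared with it. The fibre product `W` of `Q`
and `P` over `M` is an extension of `P` by `ker a`. A lift `s : Q → P` of `a` embeds `Q` in `W` by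
`q ↦ (q, s q)`, with cokernel `ker b` by `(q, y) ↦ y - s q`. -/
theorem SuperFP.ker {P : Type u} [AddCommGroup P] [Module A P] [Module.Finite A P]
    [Module.Projective A P] (hM : SuperFP A M) {b : P →ₗ[A] M} (hb : Function.Surjective b) :
    SuperFP A (LinearMap.ker b) := by
  obtain ⟨Q, a, _, _, ha, hka⟩ := hM.exists_presentation
  obtain ⟨s, hs⟩ := Module.projective_lifting_property b a hb
  have hs (q) : b (s q) = a q := congrArg (fun f => f q) hs
  let W := LinearMap.ker (a.coprod (-b))
  have hmem (w : Q × P) : w ∈ W ↔ a w.1 = b w.2 := by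
    rw [LinearMap.mem_ker, LinearMap.coprod_apply, LinearMap.neg_apply, add_neg_eq_zero]
  have hW (w : W) : a w.1.1 = b w.1.2 := (hmem _).1 w.2
  have hX : SuperFP A W := by
    refine SuperFP.of_extension (X := LinearMap.ker a) (Z := P)
      (f := (LinearMap.inl A Q P ∘ₗ (LinearMap.ker a).subtype).codRestrict _ ?_)
      (g := LinearMap.snd A Q P ∘ₗ Submodule.subtype _) ⟨?_, ?_, ?_⟩ hka .of_finite_projective
    · rintro ⟨x, hx⟩
      simp [hmem, LinearMap.mem_ker.1 hx]
    · rintro ⟨x, hx⟩ ⟨y, hy⟩ hxy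
      simpa [Subtype.ext_iff] using hxy
    · rintro w
      constructor
      · intro hy
        have hy : w.1.2 = 0 := hy
        exact ⟨⟨w.1.1, (hW w).trans (by rw [hy, map_zero])⟩, Subtype.ext (Prod.ext rfl hy.symm)⟩
      · rintro ⟨z, rfl⟩
        rfl
    · intro y
      obtain ⟨q, hq⟩ := ha (b y)
      exact ⟨⟨(q, y), (hmem _).2 hq⟩, rfl⟩
  refine SuperFP.of_cokernel (X := Q) (Y := W) (Z := LinearMap.ker b)
    (f := (LinearMap.id.prod s).codRestrict _ fun q => (hmem _).2 (hs q).symm)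
    (g := (LinearMap.snd A Q P ∘ₗ Submodule.subtype _ -
      s ∘ₗ LinearMap.fst A Q P ∘ₗ Submodule.subtype _).codRestrict _ fun w => by
        simp [hs, hW w])
    ⟨?_, ?_, ?_⟩ .of_finite_projective hX
  · intro x y hxy
    exact congrArg (fun w : W => w.1.1) hxy
  · intro w
    constructor
    · intro hw
      have hw : w.1.2 - s w.1.1 = 0 := congrArg Subtype.val hw
      exact ⟨w.1.1, Subtype.ext (Prod.ext rfl (sub_eq_zero.1 hw).symm)⟩
    · rintro ⟨q, rfl⟩
      exact Subtype.ext (sub_self (s q))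
  · rintro ⟨y, hy⟩
    exact ⟨⟨(0, y), (hmem _).2 ((map_zero a).trans hy.symm)⟩, Subtype.ext (by
      change y - s 0 = y
      rw [map_zero, sub_zero])⟩

theorem SuperFP.exists_free_presentation (hM : SuperFP A M) :
    ∃ (n : ℕ) (g : (Fin n → A) →ₗ[A] M), Function.Surjective g ∧
      SuperFP A (LinearMap.ker g) := by
  obtain ⟨Q, a, _, _, ha, -⟩ := hM.exists_presentation
  obtain ⟨n, f, hf⟩ := Module.Finite.exists_fin' A Q
  exact ⟨n, a ∘ₗ f, ha.comp hf, hM.ker (ha.comp hf)⟩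

theorem SuperFP.pi (hM : SuperFP A M) (n : ℕ) : SuperFP A (Fin n → M) := by
  induction n with
  | zero => exact .of_finite_projective
  | succ n ih =>
    refine SuperFP.of_extension (f := LinearMap.single A (fun _ : Fin (n + 1) => M) 0)
      (g := LinearMap.funLeft A M Fin.succ)
      ⟨Pi.single_injective (M := fun _ => M) 0, fun y => ?_, ?_⟩ hM ih
    · constructor
      · intro hy
        refine ⟨y 0, funext fun i => ?_⟩
        induction i using Fin.cases with
        | zero => simp
        | succ i =>
          have : y i.succ = 0 := congrFun hy i
          simp [this]
      · rintro ⟨x, rfl⟩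
        ext i
        simp
    · exact LinearMap.funLeft_surjective_of_injective _ _ _ (Fin.succ_injective n)

end SuperFPClosure

/-! ### Character modules -/

noncomputable section Characters

section AddCommGroup

variable {X Y Z : Type*} [AddCommGroup X] [AddCommGroup Y] [AddCommGroup Z]

theorem AddMonoidHom.exists_character_extension {b : X →+ Y} (hb : Function.Injective b)
    (χ : X →+ AddCircle (1 : ℚ)) : ∃ ψ : Y →+ AddCircle (1 : ℚ), ψ.comp b = χ :=
  (Module.Baer.of_divisible _).extension_property_addMonoidHom b hb χ

/-- `ℚ/ℤ` is an injective cogenerator of abelian groups, so a complex is exact if and only if its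
character dual is. This is what turns tensor statements into `Hom` statements below. -/
theorem AddMonoidHom.exact_iff_character {a : X →+ Y} {b : Y →+ Z} (hab : b.comp a = 0) :
    Function.Exact a b ↔ ∀ χ : Y →+ AddCircle (1 : ℚ), χ.comp a = 0 →
      ∃ ψ : Z →+ AddCircle (1 : ℚ), ψ.comp b = χ := by
  constructor
  · intro h χ hχ
    have hker : b.ker ≤ χ.ker := fun y hy => by
      obtain ⟨x, rfl⟩ := (h y).1 hy
      exact DFunLike.congr_fun hχ x
    -- `χ` vanishes on `ker b`, hence lives on `Y / ker b`, which embeds in `Z`.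
    obtain ⟨ψ, hψ⟩ := AddMonoidHom.exists_character_extension (QuotientAddGroup.kerLift_injective b)
      (QuotientAddGroup.lift b.ker χ hker)
    exact ⟨ψ, AddMonoidHom.ext fun y => DFunLike.congr_fun hψ (y : Y ⧸ b.ker)⟩
  · intro h y
    refine ⟨fun hy => ?_, fun ⟨x, hx⟩ => hx ▸ DFunLike.congr_fun hab x⟩
    by_contra hne
    have hne : (QuotientAddGroup.mk' a.range) y ≠ 0 := fun h0 =>
      hne ((QuotientAddGroup.eq_zero_iff y).1 h0)
    -- A character detecting the class of `y` modulo the image of `a` would factor through `b`,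
    -- although `b y = 0`.
    obtain ⟨χ, hχ⟩ := CharacterModule.exists_character_apply_ne_zero_of_ne_zero hne
    obtain ⟨ψ, hψ⟩ := h ((show _ →+ _ from χ).comp (QuotientAddGroup.mk' a.range)) <|
      AddMonoidHom.ext fun x => by
        have : (QuotientAddGroup.mk' a.range) (a x) = 0 :=
          (QuotientAddGroup.eq_zero_iff _).2 ⟨x, rfl⟩
        rw [AddMonoidHom.comp_apply, AddMonoidHom.comp_apply, this, map_zero]
        rfl
    refine hχ ((DFunLike.congr_fun hψ y).symm.trans ?_)
    rw [AddMonoidHom.comp_apply, hy, map_zero]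

theorem AddMonoidHom.injective_iff_character {b : Y →+ Z} :
    Function.Injective b ↔ ∀ χ : Y →+ AddCircle (1 : ℚ),
      ∃ ψ : Z →+ AddCircle (1 : ℚ), ψ.comp b = χ := by
  refine ⟨fun h => AddMonoidHom.exists_character_extension h, fun h => ?_⟩
  have := (AddMonoidHom.exact_iff_character (a := (0 : PUnit.{1} →+ Y)) (b := b)
    (AddMonoidHom.comp_zero b)).2 fun χ _ => h χ
  refine (injective_iff_map_eq_zero b).2 fun y hy => ?_
  obtain ⟨x, rfl⟩ := (this y).1 hy
  rfl

end AddCommGroup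

/-- The character module `Hom_ℤ(M, ℚ/ℤ)` of a left `R`-module `M`, as a right `R`-module. -/
def CharDual (R M : Type*) [Ring R] [AddCommGroup M] [Module R M] : Type _ :=
  M →+ AddCircle (1 : ℚ)

namespace CharDual

variable {R M N P : Type*} [Ring R] [AddCommGroup M] [Module R M] [AddCommGroup N] [Module R N]
  [AddCommGroup P] [Module R P]

instance : AddCommGroup (CharDual R M) := inferInstanceAs (AddCommGroup (M →+ AddCircle (1 : ℚ)))

instance : FunLike (CharDual R M) M (AddCircle (1 : ℚ)) :=
  inferInstanceAs (FunLike (M →+ AddCircle (1 : ℚ)) M _)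

instance : AddMonoidHomClass (CharDual R M) M (AddCircle (1 : ℚ)) :=
  inferInstanceAs (AddMonoidHomClass (M →+ AddCircle (1 : ℚ)) M _)

@[ext] theorem ext {f g : CharDual R M} (h : ∀ m, f m = g m) : f = g := DFunLike.ext _ _ h

@[simp] theorem add_apply (f g : CharDual R M) (m : M) : (f + g) m = f m + g m := rfl

instance : Module Rᵐᵒᵖ (CharDual R M) where
  smul r f := (show M →+ AddCircle (1 : ℚ) from f).comp (DistribSMul.toAddMonoidHom M (unop r))
  one_smul f := ext fun m => congrArg f (one_smul R m)
  mul_smul r s f := ext fun m => congrArg f (mul_smul (unop s) (unop r) m)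
  smul_zero _ := rfl
  smul_add _ _ _ := rfl
  add_smul r s f := ext fun m => (congrArg f (add_smul (unop r) (unop s) m)).trans (map_add f _ _)
  zero_smul f := ext fun m => (congrArg f (zero_smul R m)).trans (map_zero f)

@[simp] theorem smul_apply (r : Rᵐᵒᵖ) (f : CharDual R M) (m : M) : (r • f) m = f (unop r • m) := rfl

/-- The map of character modules induced by a linear map. -/
def map (f : M →ₗ[R] N) : CharDual R N →ₗ[Rᵐᵒᵖ] CharDual R M where
  toFun χ := (show N →+ AddCircle (1 : ℚ) from χ).comp f.toAddMonoidHom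
  map_add' _ _ := rfl
  map_smul' r χ := ext fun m => congrArg χ (f.map_smul (unop r) m).symm

@[simp] theorem map_apply (f : M →ₗ[R] N) (χ : CharDual R N) (m : M) : map f χ m = χ (f m) := rfl

theorem map_injective {f : M →ₗ[R] N} (hf : Function.Surjective f) :
    Function.Injective (map f) := fun χ ψ h => ext fun n => by
  obtain ⟨m, rfl⟩ := hf n
  exact DFunLike.congr_fun h m

theorem map_surjective {f : M →ₗ[R] N} (hf : Function.Injective f) :
    Function.Surjective (map f) :=
  AddMonoidHom.exists_character_extension (b := f.toAddMonoidHom) hf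

theorem map_exact {f : M →ₗ[R] N} {g : N →ₗ[R] P} (h : Function.Exact f g) :
    Function.Exact (map g) (map f) := by
  have hgf : g.toAddMonoidHom.comp f.toAddMonoidHom = 0 :=
    AddMonoidHom.ext h.apply_apply_eq_zero
  intro χ
  refine ⟨fun hχ => (AddMonoidHom.exact_iff_character hgf).1 h χ hχ, ?_⟩
  rintro ⟨ψ, rfl⟩
  refine ext fun m => ?_
  rw [map_apply, map_apply, h.apply_apply_eq_zero, map_zero]
  rfl

theorem subsingleton_iff : Subsingleton (CharDual R M) ↔ Subsingleton M := by
  refine ⟨fun h => subsingleton_of_forall_eq 0 fun m => ?_, fun h => ⟨fun f g => ext fun m => ?_⟩⟩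
  · by_contra hm
    obtain ⟨χ, hχ⟩ := CharacterModule.exists_character_apply_ne_zero_of_ne_zero hm
    exact hχ (DFunLike.congr_fun (h.elim (show CharDual R M from χ) 0) m)
  · rw [Subsingleton.elim m 0, map_zero, map_zero]

end CharDual

theorem IsShortExact.charDual {R : Type u} [Ring R] {X Y Z : Type u} [AddCommGroup X]
    [AddCommGroup Y] [AddCommGroup Z] [Module R X] [Module R Y] [Module R Z] {f : X →ₗ[R] Y}
    {g : Y →ₗ[R] Z} (h : IsShortExact f g) : IsShortExact (CharDual.map g) (CharDual.map f) :=
  ⟨CharDual.map_injective h.surjective, CharDual.map_exact h.exact,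
    CharDual.map_surjective h.injective⟩

end Characters

/-! ### Balanced tensor products and their adjunction with character modules -/

noncomputable section BalancedTensor

namespace BalancedTensor

variable {S R C M N P : Type*} [Ring S] [Ring R] [AddCommGroup C] [Module S C] [Module Rᵐᵒᵖ C]
  [AddCommGroup M] [Module R M] [AddCommGroup N] [Module R N] [AddCommGroup P]

variable (S R) in
/-- The class of `c ⊗ m`. -/
def tmul (c : C) (m : M) : BalancedTensor S R C M := Submodule.Quotient.mk (c ⊗ₜ[ℤ] m)

theorem tmul_add (c : C) (m n : M) : tmul S R c (m + n) = tmul S R c m + tmul S R c n :=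
  congrArg Submodule.Quotient.mk (TensorProduct.tmul_add c m n)

theorem add_tmul (c d : C) (m : M) : tmul S R (c + d) m = tmul S R c m + tmul S R d m :=
  congrArg Submodule.Quotient.mk (TensorProduct.add_tmul c d m)

theorem op_smul_tmul (r : R) (c : C) (m : M) : tmul S R (op r • c) m = tmul S R c (r • m) :=
  (Submodule.Quotient.eq _).2 (Submodule.subset_span ⟨c, r, m, rfl⟩)

@[elab_as_elim]
theorem induction {p : BalancedTensor S R C M → Prop} (t : BalancedTensor S R C M) (h₀ : p 0)
    (h : ∀ c m, p (tmul S R c m)) (hadd : ∀ x y, p x → p y → p (x + y)) : p t := by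
  obtain ⟨t, rfl⟩ := Submodule.Quotient.mk_surjective _ t
  induction t using TensorProduct.induction_on with
  | zero => exact h₀
  | tmul x y => exact h x y
  | add x y hx hy => exact hadd _ _ hx hy

theorem addHom_ext {f g : BalancedTensor S R C M →+ P}
    (h : ∀ c m, f (tmul S R c m) = g (tmul S R c m)) : f = g :=
  AddMonoidHom.ext fun t => induction t (by simp) h fun x y hx hy => by rw [map_add, map_add, hx, hy]

theorem hom_ext [Module S P] {f g : BalancedTensor S R C M →ₗ[S] P}
    (h : ∀ c m, f (tmul S R c m) = g (tmul S R c m)) : f = g :=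
  LinearMap.ext fun t => induction t (by simp) h fun x y hx hy => by rw [map_add, map_add, hx, hy]

variable (S) in
/-- A balanced biadditive map induces a map on the balanced tensor product. -/
def liftAddHom [SMulCommClass S Rᵐᵒᵖ C] (b : C →+ M →+ P)
    (hb : ∀ c (r : R) m, b (op r • c) m = b c (r • m)) : BalancedTensor S R C M →+ P :=
  QuotientAddGroup.lift (balancedRel S R C M).toAddSubgroup
    (TensorProduct.liftAddHom b fun n c m => by simp) <| by
    intro t ht
    rw [AddMonoidHom.mem_ker]
    replace ht : t ∈ balancedRel S R C M := ht
    -- The target has no `S`-action, so the `S`-span is rewritten as the additive closure of the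
    -- `S`-multiples of the relations; these are again relations because the two actions on `C`
    -- commute.
    rw [balancedRel, ← Submodule.mem_toAddSubmonoid, Submodule.span_eq_closure] at ht
    induction ht using AddSubmonoid.closure_induction with
    | zero => exact map_zero _
    | add x y _ _ hx hy => rw [map_add, hx, hy, add_zero]
    | mem x hx =>
      obtain ⟨s, -, _, ⟨c, r, m, rfl⟩, rfl⟩ := hx
      change TensorProduct.liftAddHom b _ (s • (_ - _)) = 0
      rw [smul_sub, TensorProduct.smul_tmul', TensorProduct.smul_tmul', map_sub,
        TensorProduct.liftAddHom_tmul, TensorProduct.liftAddHom_tmul, smul_comm, hb, sub_self]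

/-- The `S`-linear form of `liftAddHom`. -/
def lift [SMulCommClass S Rᵐᵒᵖ C] [Module S P] (b : C →+ M →+ P)
    (hb : ∀ c (r : R) m, b (op r • c) m = b c (r • m))
    (hs : ∀ (s : S) c m, b (s • c) m = s • b c m) : BalancedTensor S R C M →ₗ[S] P :=
  { liftAddHom S b hb with
    map_smul' := fun s t => by
      change liftAddHom S b hb (s • t) = s • liftAddHom S b hb t
      induction t using induction with
      | h₀ => simp
      | h c m => exact hs s c m
      | hadd x y hx hy => rw [smul_add, map_add, map_add, hx, hy, smul_add] }

variable (S C) in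
/-- The map `C ⊗_R f`. -/
def map [SMulCommClass S Rᵐᵒᵖ C] (f : M →ₗ[R] N) :
    BalancedTensor S R C M →ₗ[S] BalancedTensor S R C N :=
  lift (AddMonoidHom.mk' (fun c => AddMonoidHom.mk' (fun m => tmul S R c (f m))
      fun m n => by rw [map_add, tmul_add])
      fun c d => AddMonoidHom.ext fun m => add_tmul c d (f m))
    (fun c r m => by
      change tmul S R (op r • c) (f m) = tmul S R c (f (r • m))
      rw [op_smul_tmul, map_smul])
    fun _ _ _ => rfl

theorem map_surjective [SMulCommClass S Rᵐᵒᵖ C] {f : M →ₗ[R] N} (hf : Function.Surjective f) :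
    Function.Surjective (map S C f) := fun t => by
  induction t using induction with
  | h₀ => exact ⟨0, map_zero _⟩
  | h c m =>
    obtain ⟨m, rfl⟩ := hf m
    exact ⟨tmul S R c m, rfl⟩
  | hadd x y hx hy =>
    obtain ⟨x, rfl⟩ := hx
    obtain ⟨y, rfl⟩ := hy
    exact ⟨x + y, map_add _ _ _⟩

/-- A right `R`-linear map into the character module, as a character of the tensor product. -/
def charUncurry [SMulCommClass S Rᵐᵒᵖ C] (φ : C →ₗ[Rᵐᵒᵖ] CharDual R M) :
    BalancedTensor S R C M →+ AddCircle (1 : ℚ) :=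
  liftAddHom S φ.toAddMonoidHom fun c r m => DFunLike.congr_fun (φ.map_smul (op r) c) m

/-- A character of the tensor product, as a right `R`-linear map into the character module. -/
def charCurry (χ : BalancedTensor S R C M →+ AddCircle (1 : ℚ)) : C →ₗ[Rᵐᵒᵖ] CharDual R M where
  toFun c := AddMonoidHom.mk' (fun m => χ (tmul S R c m)) fun m n => by rw [tmul_add, map_add]
  map_add' c d := CharDual.ext fun m => by
    change χ (tmul S R (c + d) m) = χ (tmul S R c m) + χ (tmul S R d m)
    rw [add_tmul, map_add]
  map_smul' r c := CharDual.ext fun m => congrArg χ (op_smul_tmul (unop r) c m)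

/-- By adjunction the characters of `C ⊗_R M` are the maps from `C` to the character module of `M`;
injectivity is dual to surjectivity. -/
theorem map_injective_iff [SMulCommClass S Rᵐᵒᵖ C] {f : M →ₗ[R] N} :
    Function.Injective (map S C f) ↔
      ∀ φ : C →ₗ[Rᵐᵒᵖ] CharDual R M, ∃ ψ : C →ₗ[Rᵐᵒᵖ] CharDual R N, CharDual.map f ∘ₗ ψ = φ := by
  rw [← LinearMap.toAddMonoidHom_coe, AddMonoidHom.injective_iff_character]
  constructor
  · intro h φ
    obtain ⟨ψ, hψ⟩ := h (charUncurry φ)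
    exact ⟨charCurry ψ, LinearMap.ext fun c => CharDual.ext fun m =>
      DFunLike.congr_fun hψ (tmul S R c m)⟩
  · intro h χ
    obtain ⟨ψ, hψ⟩ := h (charCurry χ)
    exact ⟨charUncurry ψ, addHom_ext fun c m =>
      DFunLike.congr_fun (DFunLike.congr_fun hψ c) m⟩

theorem map_exact [Module R P] [SMulCommClass S Rᵐᵒᵖ C] {f : M →ₗ[R] N} {g : N →ₗ[R] P}
    (h : Function.Exact f g) (hg : Function.Surjective g) :
    Function.Exact (map S C f) (map S C g) := by
  refine (AddMonoidHom.exact_iff_character (a := (map S C f).toAddMonoidHom)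
    (b := (map S C g).toAddMonoidHom) ?_).2 fun χ hχ => ?_
  · refine addHom_ext fun c m => ?_
    change tmul S R c (g (f m)) = 0
    rw [h.apply_apply_eq_zero]
    exact congrArg Submodule.Quotient.mk (TensorProduct.tmul_zero P c)
  · have hmem (c) : charCurry χ c ∈ LinearMap.range (CharDual.map g) :=
      (CharDual.map_exact h _).1 (CharDual.ext fun m => DFunLike.congr_fun hχ (tmul S R c m))
    -- The dual of `g` is injective, so the curried character, with values in its range, pulls back
    -- linearly along it.
    let e := LinearEquiv.ofInjective _ (CharDual.map_injective hg)
    refine ⟨charUncurry (e.symm.toLinearMap ∘ₗ (charCurry χ).codRestrict _ hmem),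
      addHom_ext fun c m => ?_⟩
    have : CharDual.map g (e.symm ⟨charCurry χ c, hmem c⟩) = charCurry χ c :=
      congrArg Subtype.val (e.apply_symm_apply ⟨charCurry χ c, hmem c⟩)
    exact DFunLike.congr_fun this m

end BalancedTensor

end BalancedTensor

/-! ### Duality between `Tor` and `Ext`, and weak dimensions -/

noncomputable section TorDuality

variable {R : Type u} [Ring R]

theorem CategoryTheory.ProjectiveResolution.extZero_succ_iff {F : ModuleCat.{u} R}
    (P : ProjectiveResolution F) (N : Type u) [AddCommGroup N] [Module R N] (n : ℕ) :
    ExtZero R F N (n + 1) ↔ ∀ f : P.complex.X (n + 1) →ₗ[R] N,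
      f ∘ₗ (P.complex.d (n + 2) (n + 1)).hom = 0 →
      ∃ g : P.complex.X n →ₗ[R] N, g ∘ₗ (P.complex.d (n + 1) n).hom = f := by
  constructor
  · intro h f hf
    have hf' : P.complex.d (n + 2) (n + 1) ≫ ModuleCat.ofHom f = 0 := ModuleCat.hom_ext hf
    obtain ⟨g, hg⟩ := (P.extMk_eq_zero_iff (Y := ModuleCat.of R N) (ModuleCat.ofHom f) (n + 2) rfl
      hf' n rfl).1 (h.elim _ _)
    exact ⟨g.hom, congrArg ModuleCat.Hom.hom hg⟩
  · intro h
    refine subsingleton_of_forall_eq 0 fun x => ?_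
    obtain ⟨f, hf, rfl⟩ := P.extMk_surjective (Y := ModuleCat.of R N) x (n + 2) rfl
    obtain ⟨g, hg⟩ := h f.hom (congrArg ModuleCat.Hom.hom hf)
    exact (P.extMk_eq_zero_iff f (n + 2) rfl hf n rfl).2 ⟨ModuleCat.ofHom g, ModuleCat.hom_ext hg⟩

theorem CategoryTheory.ProjectiveResolution.ringTor_succ_iff {F : ModuleCat.{u} Rᵐᵒᵖ}
    (P : ProjectiveResolution F) (M : ModuleCat.{u} R) (n : ℕ) :
    Subsingleton (RingTor (n + 1) F M) ↔
      Function.Exact (balancedTensorMap M (P.complex.d (n + 2) (n + 1)).hom)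
        (balancedTensorMap M (P.complex.d (n + 1) n).hom) := by
  have e := P.isoLeftDerivedObj (rightTensorFunctor M) (n + 1)
  rw [← ModuleCat.isZero_iff_subsingleton]
  refine (Iso.isZero_iff e).trans ?_
  refine Iff.trans (HomologicalComplex.exactAt_iff_isZero_homology _ _).symm ?_
  rw [HomologicalComplex.exactAt_iff' _ (n + 2) (n + 1) n (by simp) (by simp),
    ShortComplex.ShortExact.moduleCat_exact_iff_function_exact]
  rfl

/-- `Tor` vanishes in positive degree if and only if `Ext` into the character module does. -/
theorem ringTor_succ_iff_extZero (F : ModuleCat.{u} Rᵐᵒᵖ) (M : ModuleCat.{u} R) (n : ℕ) :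
    Subsingleton (RingTor (n + 1) F M) ↔ ExtZero Rᵐᵒᵖ F (CharDual R M) (n + 1) := by
  let P := projectiveResolution F
  rw [P.ringTor_succ_iff, P.extZero_succ_iff]
  refine (AddMonoidHom.exact_iff_character
    (a := (balancedTensorMap M (P.complex.d (n + 2) (n + 1)).hom).toAddMonoidHom)
    (b := (balancedTensorMap M (P.complex.d (n + 1) n).hom).toAddMonoidHom) ?_).trans ?_
  · refine BalancedTensor.addHom_ext fun x m => ?_
    have : (P.complex.d (n + 1) n).hom ((P.complex.d (n + 2) (n + 1)).hom x) = 0 :=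
      congrArg (fun f => f.hom x) (P.complex.d_comp_d (n + 2) (n + 1) n)
    change BalancedTensor.tmul ℤ R ((P.complex.d (n + 1) n).hom
      ((P.complex.d (n + 2) (n + 1)).hom x)) m = 0
    rw [this]
    exact congrArg Submodule.Quotient.mk (TensorProduct.zero_tmul _ m)
  constructor
  · intro h f hf
    obtain ⟨g, hg⟩ := h (BalancedTensor.charUncurry f) <| BalancedTensor.addHom_ext fun x m =>
      DFunLike.congr_fun (DFunLike.congr_fun hf x) m
    exact ⟨BalancedTensor.charCurry g, LinearMap.ext fun x => CharDual.ext fun m =>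
      DFunLike.congr_fun hg (BalancedTensor.tmul ℤ R x m)⟩
  · intro h χ hχ
    obtain ⟨g, hg⟩ := h (BalancedTensor.charCurry χ) <| LinearMap.ext fun x => CharDual.ext fun m =>
      DFunLike.congr_fun hχ (BalancedTensor.tmul ℤ R x m)
    exact ⟨BalancedTensor.charUncurry g, BalancedTensor.addHom_ext fun x m =>
      DFunLike.congr_fun (DFunLike.congr_fun hg x) m⟩

section LeftExactness

variable {M : Type*} [AddCommGroup M] [Module R M]
  {X Y Z : Type u} [AddCommGroup X] [Module Rᵐᵒᵖ X] [AddCommGroup Y] [Module Rᵐᵒᵖ Y]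
  [AddCommGroup Z] [Module Rᵐᵒᵖ Z] {f : X →ₗ[Rᵐᵒᵖ] Y} {g : Y →ₗ[Rᵐᵒᵖ] Z}

theorem balancedTensorMap_injective_iff :
    Function.Injective (balancedTensorMap M f) ↔
      ∀ φ : X →ₗ[Rᵐᵒᵖ] CharDual R M, ∃ ψ : Y →ₗ[Rᵐᵒᵖ] CharDual R M, ψ ∘ₗ f = φ := by
  rw [← LinearMap.toAddMonoidHom_coe, AddMonoidHom.injective_iff_character]
  constructor
  · intro h φ
    obtain ⟨ψ, hψ⟩ := h (BalancedTensor.charUncurry φ)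
    exact ⟨BalancedTensor.charCurry ψ, LinearMap.ext fun c => CharDual.ext fun m =>
      DFunLike.congr_fun hψ (BalancedTensor.tmul ℤ R c m)⟩
  · intro h χ
    obtain ⟨ψ, hψ⟩ := h (BalancedTensor.charCurry χ)
    exact ⟨BalancedTensor.charUncurry ψ, BalancedTensor.addHom_ext fun c m =>
      DFunLike.congr_fun (DFunLike.congr_fun hψ c) m⟩

theorem balancedTensorMap_surjective (hg : Function.Surjective g) :
    Function.Surjective (balancedTensorMap M g) := fun t => by
  induction t using BalancedTensor.induction with
  | h₀ => exact ⟨0, map_zero _⟩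
  | h c m =>
    obtain ⟨c, rfl⟩ := hg c
    exact ⟨.tmul ℤ R c m, rfl⟩
  | hadd x y hx hy =>
    obtain ⟨x, rfl⟩ := hx
    obtain ⟨y, rfl⟩ := hy
    exact ⟨x + y, map_add _ _ _⟩

theorem IsShortExact.balancedTensorMap_exact (h : IsShortExact f g) :
    Function.Exact (balancedTensorMap M f) (balancedTensorMap M g) := by
  refine (AddMonoidHom.exact_iff_character (a := (balancedTensorMap M f).toAddMonoidHom)
    (b := (balancedTensorMap M g).toAddMonoidHom) ?_).2 fun χ hχ => ?_
  · refine BalancedTensor.addHom_ext fun c m => ?_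
    change BalancedTensor.tmul ℤ R (g (f c)) m = 0
    rw [h.exact.apply_apply_eq_zero]
    exact congrArg Submodule.Quotient.mk (TensorProduct.zero_tmul _ m)
  · obtain ⟨l, hl⟩ := h.exists_desc (BalancedTensor.charCurry χ) <| LinearMap.ext fun x =>
      CharDual.ext fun m => DFunLike.congr_fun hχ (BalancedTensor.tmul ℤ R x m)
    exact ⟨BalancedTensor.charUncurry l, BalancedTensor.addHom_ext fun c m =>
      DFunLike.congr_fun (DFunLike.congr_fun hl c) m⟩

end LeftExactness

section Dimension

variable {M N K : Type u} [AddCommGroup M] [Module R M] [AddCommGroup N] [Module R N]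
  [AddCommGroup K] [Module R K]

variable (R) in
/-- `wid_R(N) ≤ n`. -/
def WeakInjDimLE (n : ℕ) (N : Type u) [AddCommGroup N] [Module R N] : Prop :=
  ∀ F : ModuleCat.{u} R, IsSuperFinitelyPresented F → ExtZero R F N (n + 1)

variable (R) in
/-- `wfd_R(M) ≤ n`. -/
def WeakFlatDimLE (n : ℕ) (M : Type u) [AddCommGroup M] [Module R M] : Prop :=
  WeakInjDimLE Rᵐᵒᵖ n (CharDual R M)

theorem isWeakInjective_iff (N : ModuleCat.{u} R) : IsWeakInjective N ↔ WeakInjDimLE R 0 N :=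
  Iff.rfl

theorem isWeakFlat_iff (M : ModuleCat.{u} R) : IsWeakFlat M ↔ WeakFlatDimLE R 0 M :=
  forall₂_congr fun F _ => ringTor_succ_iff_extZero F M 0

theorem weakInjectiveDim_eq (N : ModuleCat.{u} R) :
    weakInjectiveDim N = ⨅ (n : ℕ) (_ : WeakInjDimLE R n N), (n : ℕ∞) := rfl

theorem weakFlatDim_eq (M : ModuleCat.{u} R) :
    weakFlatDim M = ⨅ (n : ℕ) (_ : WeakFlatDimLE R n M), (n : ℕ∞) := by
  have key : ∀ n : ℕ, (∀ F : ModuleCat.{u} Rᵐᵒᵖ, IsSuperFinitelyPresented F →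
      Subsingleton (RingTor (n + 1) F M)) = WeakFlatDimLE R n M :=
    fun n => propext (forall₂_congr fun F _ => ringTor_succ_iff_extZero F M n)
  simp only [weakFlatDim, key]

theorem WeakInjDimLE.congr (e : M ≃ₗ[R] N) {n : ℕ} (h : WeakInjDimLE R n M) :
    WeakInjDimLE R n N := fun F hF => (h F hF).congr_right e

/-- Dimension shifting: a super finitely presented module has a super finitely presented syzygy. -/
theorem WeakInjDimLE.succ {n : ℕ} (h : WeakInjDimLE R n N) : WeakInjDimLE R (n + 1) N := by
  intro F hF
  obtain ⟨Q, g, _, _, hg, hk⟩ := SuperFP.exists_presentation (M := F) hF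
  exact ExtZero.contravariant₃ (IsShortExact.ker hg) (h _ hk) (.of_projective _)

theorem WeakInjDimLE.mono {m n : ℕ} (hmn : m ≤ n) (h : WeakInjDimLE R m N) : WeakInjDimLE R n N :=
  Nat.le_induction h (fun _ _ => succ) n hmn

theorem WeakInjDimLE.of_injective [Injective (ModuleCat.of R N)] (n : ℕ) : WeakInjDimLE R n N :=
  fun _ _ => .of_injective n

theorem WeakInjDimLE.cokernel {f : M →ₗ[R] N} {g : N →ₗ[R] K} (h : IsShortExact f g) {n : ℕ}
    (hN : WeakInjDimLE R n N) (hM : WeakInjDimLE R (n + 1) M) : WeakInjDimLE R n K :=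
  fun F hF => ExtZero.covariant₃ h (hN F hF) (hM F hF)

theorem WeakInjDimLE.kernel {f : M →ₗ[R] N} {g : N →ₗ[R] K} (h : IsShortExact f g) {n : ℕ}
    (hN : WeakInjDimLE R (n + 1) N) (hK : WeakInjDimLE R n K) : WeakInjDimLE R (n + 1) M :=
  fun F hF => ExtZero.covariant₁ h (hK F hF) (hN F hF)

/-- A map from `X` into the character module of a free module is a family of characters of `X`, one
for each basis element. Each of them extends to `Y` separately since `ℚ/ℤ` is divisible. -/
theorem CharDual.injective_finsupp (ι : Type u) :
    Injective (ModuleCat.of Rᵐᵒᵖ (CharDual R (ι →₀ R))) := by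
  refine ⟨fun {X Y} g f hf => ?_⟩
  have hf' : Function.Injective f.hom := (ModuleCat.mono_iff_injective _).1 hf
  let single (i : ι) : X →+ AddCircle (1 : ℚ) :=
    AddMonoidHom.mk' (fun x => (show CharDual R (ι →₀ R) from g.hom x) (Finsupp.single i 1))
      fun x y => by rw [map_add]; rfl
  choose χ hχ using fun i =>
    AddMonoidHom.exists_character_extension (b := f.hom.toAddMonoidHom) hf' (single i)
  -- The value at `r` times the `i`-th basis element is forced by linearity in `y` to be `χ i` of `y
  -- r`.
  let G (y : Y) : CharDual R (ι →₀ R) :=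
    Finsupp.liftAddHom fun i => AddMonoidHom.mk' (fun r : R => χ i (op r • y)) fun r s => by
      rw [MulOpposite.op_add, add_smul, map_add]
  have hG (y : Y) (i : ι) (r : R) : G y (Finsupp.single i r) = χ i (op r • y) :=
    Finsupp.liftAddHom_apply_single ..
  have hext {a b : CharDual R (ι →₀ R)}
      (h : ∀ i r, a (Finsupp.single i r) = b (Finsupp.single i r)) : a = b :=
    Finsupp.addHom_ext h
  refine ⟨ModuleCat.ofHom ⟨⟨G, fun x y => hext fun i r => ?_⟩, fun r y => hext fun i s => ?_⟩, ?_⟩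
  · rw [CharDual.add_apply, hG, hG, hG, smul_add, map_add]
  · rw [RingHom.id_apply, CharDual.smul_apply, Finsupp.smul_single, hG, hG, smul_smul, smul_eq_mul,
      MulOpposite.op_mul, MulOpposite.op_unop]
  · refine ModuleCat.hom_ext (LinearMap.ext fun x => hext fun i r => ?_)
    have h₁ : χ i (f.hom (op r • x)) = single i (op r • x) := DFunLike.congr_fun (hχ i) _
    change G (f.hom x) _ = _
    rw [hG, ← map_smul, h₁]
    change (g.hom (op r • x) : CharDual R (ι →₀ R)) (Finsupp.single i 1) = _
    rw [map_smul]
    change (g.hom x : CharDual R (ι →₀ R)) (r • Finsupp.single i 1) = _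
    rw [Finsupp.smul_single, smul_eq_mul, mul_one]

theorem WeakFlatDimLE.congr (e : M ≃ₗ[R] N) {n : ℕ} (h : WeakFlatDimLE R n M) :
    WeakFlatDimLE R n N :=
  WeakInjDimLE.congr (LinearEquiv.ofBijective (CharDual.map e.symm.toLinearMap)
    ⟨CharDual.map_injective e.symm.surjective, CharDual.map_surjective e.symm.injective⟩) h

theorem WeakFlatDimLE.finsupp (ι : Type u) (n : ℕ) : WeakFlatDimLE R n (ι →₀ R) :=
  have := CharDual.injective_finsupp (R := R) ι
  WeakInjDimLE.of_injective n

theorem WeakFlatDimLE.kernel {f : M →ₗ[R] N} {g : N →ₗ[R] K} (h : IsShortExact f g) {n : ℕ}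
    (hN : WeakFlatDimLE R n N) (hK : WeakFlatDimLE R (n + 1) K) : WeakFlatDimLE R n M :=
  WeakInjDimLE.cokernel h.charDual hN hK

theorem WeakFlatDimLE.cokernel {f : M →ₗ[R] N} {g : N →ₗ[R] K} (h : IsShortExact f g) {n : ℕ}
    (hN : WeakFlatDimLE R (n + 1) N) (hM : WeakFlatDimLE R n M) : WeakFlatDimLE R (n + 1) K :=
  WeakInjDimLE.kernel h.charDual hN hM

end Dimension

end TorDuality

/-! ### The adjunction between `C ⊗_R -` and `Hom_S(C, -)` -/

noncomputable section FoxbyFunctors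

namespace BimodHom

variable {S R C N N' N'' : Type*} [Ring S] [Ring R] [AddCommGroup C] [Module S C] [Module Rᵐᵒᵖ C]
  [SMulCommClass S Rᵐᵒᵖ C] [AddCommGroup N] [Module S N] [AddCommGroup N'] [Module S N']
  [AddCommGroup N''] [Module S N'']

instance : FunLike (BimodHom S R C N) C N := inferInstanceAs (FunLike (C →ₗ[S] N) C N)

instance : LinearMapClass (BimodHom S R C N) S C N :=
  inferInstanceAs (LinearMapClass (C →ₗ[S] N) S C N)

@[ext] theorem ext {f g : BimodHom S R C N} (h : ∀ c, f c = g c) : f = g := DFunLike.ext _ _ h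

variable (R C) in
/-- The map `Hom_S(C, g)`. -/
def map (g : N →ₗ[S] N') : BimodHom S R C N →ₗ[R] BimodHom S R C N' where
  toFun f := g ∘ₗ (show C →ₗ[S] N from f)
  map_add' _ _ := ext fun _ => map_add g _ _
  map_smul' _ _ := rfl

theorem map_injective {g : N →ₗ[S] N'} (hg : Function.Injective g) :
    Function.Injective (map R C g) := fun _ _ h => ext fun c => hg (DFunLike.congr_fun h c)

theorem map_exact {f : N →ₗ[S] N'} {g : N' →ₗ[S] N''} (hf : Function.Injective f)
    (h : Function.Exact f g) : Function.Exact (map R C f) (map R C g) := by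
  intro k
  constructor
  · intro hk
    have hmem (c) : k c ∈ LinearMap.range f := (h _).1 (DFunLike.congr_fun hk c)
    refine ⟨(LinearEquiv.ofInjective f hf).symm.toLinearMap ∘ₗ
      (show C →ₗ[S] N' from k).codRestrict _ hmem, ext fun c => ?_⟩
    exact congrArg Subtype.val ((LinearEquiv.ofInjective f hf).apply_symm_apply ⟨k c, hmem c⟩)
  · rintro ⟨l, rfl⟩
    exact ext fun c => h.apply_apply_eq_zero _

end BimodHom

section UnitCounit

variable {S R C M M' N N' : Type*} [Ring S] [Ring R] [AddCommGroup C] [Module S C] [Module Rᵐᵒᵖ C]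
  [SMulCommClass S Rᵐᵒᵖ C] [AddCommGroup M] [Module R M] [AddCommGroup M'] [Module R M']
  [AddCommGroup N] [Module S N] [AddCommGroup N'] [Module S N']

variable (S R C M) in
/-- The unit `M → Hom_S(C, C ⊗_R M)`. -/
def foxbyUnit : M →ₗ[R] BimodHom S R C (BalancedTensor S R C M) where
  toFun m := show C →ₗ[S] _ from
    { toFun := fun c => .tmul S R c m
      map_add' := fun c d => BalancedTensor.add_tmul c d m
      map_smul' := fun _ _ => rfl }
  map_add' m n := BimodHom.ext fun c => BalancedTensor.tmul_add c m n
  map_smul' r m := BimodHom.ext fun c => (BalancedTensor.op_smul_tmul r c m).symm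

variable (S R C N) in
/-- The counit `C ⊗_R Hom_S(C, N) → N`. -/
def foxbyCounit : BalancedTensor S R C (BimodHom S R C N) →ₗ[S] N :=
  BalancedTensor.lift
    (AddMonoidHom.mk' (fun c => AddMonoidHom.mk' (fun f : BimodHom S R C N => f c) fun _ _ => rfl)
      fun c d => AddMonoidHom.ext fun f => map_add f c d)
    (fun _ _ _ => rfl) fun s c f => map_smul f s c

theorem foxbyUnit_naturality (f : M →ₗ[R] M') (m : M) :
    BimodHom.map R C (BalancedTensor.map S C f) (foxbyUnit S R C M m) =
      foxbyUnit S R C M' (f m) := rfl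

theorem foxbyCounit_naturality (g : N →ₗ[S] N') (t : BalancedTensor S R C (BimodHom S R C N)) :
    foxbyCounit S R C N' (BalancedTensor.map S C (BimodHom.map R C g) t) =
      g (foxbyCounit S R C N t) :=
  LinearMap.congr_fun (f := foxbyCounit S R C N' ∘ₗ BalancedTensor.map S C (BimodHom.map R C g))
    (g := g ∘ₗ foxbyCounit S R C N) (BalancedTensor.hom_ext fun _ _ => rfl) t

theorem foxbyCounit_map_foxbyUnit (t : BalancedTensor S R C M) :
    foxbyCounit S R C _ (BalancedTensor.map S C (foxbyUnit S R C M) t) = t :=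
  LinearMap.congr_fun (f := foxbyCounit S R C _ ∘ₗ BalancedTensor.map S C (foxbyUnit S R C M))
    (g := LinearMap.id) (BalancedTensor.hom_ext fun _ _ => rfl) t

theorem BalancedTensor.map_bijective {f : M →ₗ[R] M'} (hf : Function.Bijective f) :
    Function.Bijective (BalancedTensor.map S C f) := by
  refine ⟨?_, map_surjective hf.2⟩
  let e := LinearEquiv.ofBijective f hf
  refine Function.LeftInverse.injective (g := BalancedTensor.map S C e.symm.toLinearMap) fun t => ?_
  refine LinearMap.congr_fun (f := BalancedTensor.map S C e.symm.toLinearMap ∘ₗ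
    BalancedTensor.map S C f) (g := LinearMap.id) (BalancedTensor.hom_ext fun c m => ?_) t
  exact congrArg (tmul S R c) (e.symm_apply_apply m)

theorem BimodHom.map_bijective {g : N →ₗ[S] N'} (hg : Function.Bijective g) :
    Function.Bijective (BimodHom.map R C g) := by
  refine ⟨map_injective hg.1, fun f => ?_⟩
  let e := LinearEquiv.ofBijective g hg
  exact ⟨e.symm.toLinearMap ∘ₗ (show C →ₗ[S] N' from f),
    BimodHom.ext fun c => e.apply_symm_apply (f c)⟩

end UnitCounit

end FoxbyFunctors

/-! ### Two cases of the five lemma -/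

section FiveLemma

variable {A : Type u} [Ring A] {X Y Z X' Y' Z' : Type u}
  [AddCommGroup X] [AddCommGroup Y] [AddCommGroup Z] [AddCommGroup X'] [AddCommGroup Y']
  [AddCommGroup Z'] [Module A X] [Module A Y] [Module A Z] [Module A X'] [Module A Y'] [Module A Z']
  {f : X →ₗ[A] Y} {g : Y →ₗ[A] Z} {f' : X' →ₗ[A] Y'} {g' : Y' →ₗ[A] Z'}
  {a : X →ₗ[A] X'} {b : Y →ₗ[A] Y'} {c : Z →ₗ[A] Z'}

theorem IsShortExact.bijective_right (h : IsShortExact f g) (h' : IsShortExact f' g')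
    (hab : ∀ x, b (f x) = f' (a x)) (hbc : ∀ y, c (g y) = g' (b y)) (ha : Function.Surjective a)
    (hb : Function.Bijective b) : Function.Bijective c := by
  constructor
  · refine (injective_iff_map_eq_zero c).2 fun z hz => ?_
    obtain ⟨y, rfl⟩ := h.surjective z
    obtain ⟨x', hx'⟩ := (h'.exact (b y)).1 (by rw [← hbc, hz])
    obtain ⟨x, rfl⟩ := ha x'
    rw [← hb.1 ((hab x).trans hx')]
    exact h.exact.apply_apply_eq_zero x
  · intro z'
    obtain ⟨y', rfl⟩ := h'.surjective z'
    obtain ⟨y, rfl⟩ := hb.2 y'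
    exact ⟨g y, hbc y⟩

theorem IsShortExact.bijective_left (h : IsShortExact f g) (h' : IsShortExact f' g')
    (hab : ∀ x, b (f x) = f' (a x)) (hbc : ∀ y, c (g y) = g' (b y)) (hb : Function.Bijective b)
    (hc : Function.Injective c) : Function.Bijective a := by
  constructor
  · refine (injective_iff_map_eq_zero a).2 fun x hx => h.injective (hb.1 ?_)
    rw [hab, hx, map_zero, map_zero, map_zero]
  · intro x'
    obtain ⟨y, hy⟩ := hb.2 (f' x')
    obtain ⟨x, rfl⟩ := (h.exact y).1 (hc (by
      rw [hbc, hy, h'.exact.apply_apply_eq_zero, map_zero]))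
    exact ⟨x, h'.injective (by rw [← hab, hy])⟩

end FiveLemma

/-! ### Auslander and Bass classes -/

section FoxbyClasses

variable {S R C : Type u} [Ring S] [Ring R] [AddCommGroup C] [Module S C] [Module Rᵐᵒᵖ C]
  [SMulCommClass S Rᵐᵒᵖ C]

variable (S R C) in
/-- The Auslander class. The vanishing of `Tor_i^R(C, M)` is expressed by that of
`Ext^i(C, Hom_ℤ(M, ℚ/ℤ))`. -/
structure InAuslander (M : Type u) [AddCommGroup M] [Module R M] : Prop where
  tor : ∀ n, ExtZero Rᵐᵒᵖ C (CharDual R M) (n + 1)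
  ext : ∀ n, ExtZero S C (BalancedTensor S R C M) (n + 1)
  unit : Function.Bijective (foxbyUnit S R C M)

variable (S R C) in
/-- The Bass class. The vanishing of `Tor_i^R(C, Hom_S(C, N))` is expressed as in `InAuslander`. -/
structure InBass (N : Type u) [AddCommGroup N] [Module S N] : Prop where
  ext : ∀ n, ExtZero S C N (n + 1)
  tor : ∀ n, ExtZero Rᵐᵒᵖ C (CharDual R (BimodHom S R C N)) (n + 1)
  counit : Function.Bijective (foxbyCounit S R C N)

section

variable {M M' M'' N N' N'' : Type u} [AddCommGroup M] [Module R M] [AddCommGroup M'] [Module R M']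
  [AddCommGroup M''] [Module R M''] [AddCommGroup N] [Module S N] [AddCommGroup N'] [Module S N']
  [AddCommGroup N''] [Module S N'']

/-- The isomorphism of character modules induced by a linear isomorphism. -/
noncomputable def CharDual.congr (e : M ≃ₗ[R] M') : CharDual R M' ≃ₗ[Rᵐᵒᵖ] CharDual R M :=
  LinearEquiv.ofBijective (CharDual.map e.toLinearMap)
    ⟨CharDual.map_injective e.surjective, CharDual.map_surjective e.injective⟩

theorem IsShortExact.bimodHom {f : N →ₗ[S] N'} {g : N' →ₗ[S] N''} (h : IsShortExact f g)
    (hN : ExtZero S C N 1) : IsShortExact (BimodHom.map R C f) (BimodHom.map R C g) :=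
  ⟨BimodHom.map_injective h.injective, BimodHom.map_exact h.injective h.exact,
    hN.exists_lift h⟩

theorem IsShortExact.extZero_one_of_surjective {f : N →ₗ[S] N'} {g : N' →ₗ[S] N''}
    (h : IsShortExact f g) (hN' : ExtZero S C N' 1)
    (hg : Function.Surjective (BimodHom.map R C g)) : ExtZero S C N 1 :=
  ExtZero.one_of_forall_lift h hN' hg

theorem IsShortExact.balancedTensor {f : M →ₗ[R] M'} {g : M' →ₗ[R] M''} (h : IsShortExact f g)
    (hM : ExtZero Rᵐᵒᵖ C (CharDual R M'') 1) :
    IsShortExact (BalancedTensor.map S C f) (BalancedTensor.map S C g) :=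
  ⟨BalancedTensor.map_injective_iff.2 (hM.exists_lift h.charDual),
    BalancedTensor.map_exact h.exact h.surjective, BalancedTensor.map_surjective h.surjective⟩

theorem IsShortExact.extZero_one_of_injective {f : M →ₗ[R] M'} {g : M' →ₗ[R] M''}
    (h : IsShortExact f g) (hM' : ExtZero Rᵐᵒᵖ C (CharDual R M') 1)
    (hf : Function.Injective (BalancedTensor.map S C f)) : ExtZero Rᵐᵒᵖ C (CharDual R M'') 1 :=
  ExtZero.one_of_forall_lift h.charDual hM' (BalancedTensor.map_injective_iff.1 hf)

/-- Tensoring with `C` stays exact because `Tor₁(C, M'') = 0`. Every map `C → C ⊗_R M''` comes from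
`M''` through the unit and so lifts to `C ⊗_R M'`; this forces `Ext¹(C, C ⊗_R M) = 0`, and the five
lemma handles the unit. -/
theorem InAuslander.kernel {f : M →ₗ[R] M'} {g : M' →ₗ[R] M''} (h : IsShortExact f g)
    (hM' : InAuslander S R C M') (hM'' : InAuslander S R C M'') : InAuslander S R C M := by
  have ht : IsShortExact (BalancedTensor.map S C f) (BalancedTensor.map S C g) :=
    h.balancedTensor (hM''.tor 0)
  have hs : Function.Surjective (BimodHom.map R C (BalancedTensor.map S C g)) := fun k => by
    obtain ⟨m, rfl⟩ := hM''.unit.2 k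
    obtain ⟨m', rfl⟩ := h.surjective m
    exact ⟨_, foxbyUnit_naturality g m'⟩
  have hext (n) : ExtZero S C (BalancedTensor S R C M) (n + 1) := by
    cases n with
    | zero => exact ht.extZero_one_of_surjective (hM'.ext 0) hs
    | succ n => exact ExtZero.covariant₁ ht (hM''.ext n) (hM'.ext (n + 1))
  exact ⟨fun n => ExtZero.covariant₃ h.charDual (hM'.tor n) (hM''.tor (n + 1)), hext,
    h.bijective_left (ht.bimodHom (hext 0)) (fun _ => rfl) (fun _ => rfl) hM'.unit hM''.unit.1⟩

/-- Dual to `InAuslander.kernel`: through the counits, `C ⊗_R Hom_S(C, f)` is identified with the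
injective map `f`, which yields the vanishing of `Tor₁`. -/
theorem InBass.cokernel {f : N →ₗ[S] N'} {g : N' →ₗ[S] N''} (h : IsShortExact f g)
    (hN : InBass S R C N) (hN' : InBass S R C N') : InBass S R C N'' := by
  have hh : IsShortExact (BimodHom.map R C f) (BimodHom.map R C g) := h.bimodHom (hN.ext 0)
  have hi : Function.Injective (BalancedTensor.map S C (BimodHom.map R C f)) := fun x y hxy => by
    refine hN.counit.1 (h.injective ?_)
    rw [← foxbyCounit_naturality, ← foxbyCounit_naturality, hxy]
  have htor (n) : ExtZero Rᵐᵒᵖ C (CharDual R (BimodHom S R C N'')) (n + 1) := by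
    cases n with
    | zero => exact hh.extZero_one_of_injective (hN'.tor 0) hi
    | succ n => exact ExtZero.covariant₁ hh.charDual (hN.tor n) (hN'.tor (n + 1))
  exact ⟨fun n => ExtZero.covariant₃ h (hN'.ext n) (hN.ext (n + 1)), htor,
    (hh.balancedTensor (htor 0)).bijective_right h (foxbyCounit_naturality f)
      (foxbyCounit_naturality g) hN.counit.2 hN'.counit⟩

theorem InAuslander.inBass (h : InAuslander S R C M) : InBass S R C (BalancedTensor S R C M) :=
  ⟨h.ext, fun n => (h.tor n).congr_right (CharDual.congr (LinearEquiv.ofBijective _ h.unit)).symm,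
    -- By the triangle identity the counit is inverse to `C ⊗` unit.
    (Function.Bijective.of_comp_iff _ (BalancedTensor.map_bijective h.unit)).1 <| by
      convert Function.bijective_id using 1
      exact funext foxbyCounit_map_foxbyUnit⟩

theorem InBass.inAuslander (h : InBass S R C N) : InAuslander S R C (BimodHom S R C N) :=
  ⟨h.tor, fun n => (h.ext n).congr_right (LinearEquiv.ofBijective _ h.counit).symm,
    (Function.Bijective.of_comp_iff' (BimodHom.map_bijective h.counit) _).1 Function.bijective_id⟩

end

section Faithful

variable (hC : IsFaithfullySemidualizing S R C)
include hC

variable {M M' M'' N N' N'' : Type u} [AddCommGroup M] [Module R M] [AddCommGroup M'] [Module R M']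
  [AddCommGroup M''] [Module R M''] [AddCommGroup N] [Module S N] [AddCommGroup N'] [Module S N']
  [AddCommGroup N''] [Module S N'']

/-- The characters of `C ⊗_R M` are `Hom(C, Hom_ℤ(M, ℚ/ℤ))`, to which faithfulness on the right
applies. -/
theorem IsFaithfullySemidualizing.subsingleton_of_tensor
    (h : Subsingleton (BalancedTensor S R C M)) : Subsingleton M := by
  refine (CharDual.subsingleton_iff (R := R)).1
    (hC.faithful_right (ModuleCat.of Rᵐᵒᵖ (CharDual R M)) ⟨fun φ ψ => ?_⟩)
  have : BalancedTensor.charUncurry (S := S) φ = BalancedTensor.charUncurry ψ :=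
    AddMonoidHom.ext fun t => by rw [Subsingleton.elim t 0, map_zero, map_zero]
  exact congrArg BalancedTensor.charCurry this

theorem IsFaithfullySemidualizing.subsingleton_of_hom
    (h : Subsingleton (BimodHom S R C N)) : Subsingleton N :=
  hC.faithful_left (ModuleCat.of S N) h

theorem IsFaithfullySemidualizing.surjective_of_tensor {f : M →ₗ[R] M'}
    (hf : Function.Surjective (BalancedTensor.map S C f)) : Function.Surjective f := by
  rw [← LinearMap.range_eq_top, ← Submodule.Quotient.subsingleton_iff]
  refine hC.subsingleton_of_tensor (subsingleton_of_forall_eq 0 fun t => ?_)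
  obtain ⟨t, rfl⟩ := BalancedTensor.map_surjective (S := S) (C := C)
    (Submodule.mkQ_surjective (LinearMap.range f)) t
  obtain ⟨t, rfl⟩ := hf t
  exact (BalancedTensor.map_exact (LinearMap.exact_map_mkQ_range f)
    (Submodule.mkQ_surjective _)).apply_apply_eq_zero t

theorem IsFaithfullySemidualizing.injective_of_hom {f : N →ₗ[S] N'}
    (hf : Function.Injective (BimodHom.map R C f)) : Function.Injective f := by
  rw [← LinearMap.ker_eq_bot, ← Submodule.subsingleton_iff_eq_bot]
  refine hC.subsingleton_of_hom (subsingleton_of_forall_eq 0 fun φ => ?_)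
  refine BimodHom.map_injective (g := (LinearMap.ker f).subtype) Subtype.val_injective (hf ?_)
  rw [map_zero, map_zero]
  exact BimodHom.ext fun c => (φ c).2

/-- Nothing is known beforehand about `Tor₁(C, M'')`, so the injectivity of `C ⊗ f` needs
faithfulness: it may be tested after applying `Hom_S(C, -)`, where the units turn the map into `f`.
-/
theorem InAuslander.cokernel {f : M →ₗ[R] M'} {g : M' →ₗ[R] M''} (h : IsShortExact f g)
    (hM : InAuslander S R C M) (hM' : InAuslander S R C M') : InAuslander S R C M'' := by
  have hi : Function.Injective (BalancedTensor.map S C f) := by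
    refine hC.injective_of_hom fun x y hxy => ?_
    obtain ⟨x, rfl⟩ := hM.unit.2 x
    obtain ⟨y, rfl⟩ := hM.unit.2 y
    rw [foxbyUnit_naturality, foxbyUnit_naturality] at hxy
    rw [h.injective (hM'.unit.1 hxy)]
  have htor (n) : ExtZero Rᵐᵒᵖ C (CharDual R M'') (n + 1) := by
    cases n with
    | zero => exact h.extZero_one_of_injective (hM'.tor 0) hi
    | succ n => exact ExtZero.covariant₁ h.charDual (hM.tor n) (hM'.tor (n + 1))
  have ht : IsShortExact (BalancedTensor.map S C f) (BalancedTensor.map S C g) :=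
    h.balancedTensor (htor 0)
  exact ⟨htor, fun n => ExtZero.covariant₃ ht (hM'.ext n) (hM.ext (n + 1)),
    h.bijective_right (ht.bimodHom (hM.ext 0)) (fun _ => rfl) (fun _ => rfl) hM.unit.2 hM'.unit⟩

/-- Surjectivity of `Hom_S(C, g)` may be tested after tensoring with `C`, where the counits turn the
map into `g`. -/
theorem InBass.kernel {f : N →ₗ[S] N'} {g : N' →ₗ[S] N''} (h : IsShortExact f g)
    (hN' : InBass S R C N') (hN'' : InBass S R C N'') : InBass S R C N := by
  have hs : Function.Surjective (BimodHom.map R C g) := by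
    refine hC.surjective_of_tensor fun t => ?_
    obtain ⟨y, hy⟩ := h.surjective (foxbyCounit S R C N'' t)
    obtain ⟨t', rfl⟩ := hN'.counit.2 y
    exact ⟨t', hN''.counit.1 ((foxbyCounit_naturality g t').trans hy)⟩
  have hext (n) : ExtZero S C N (n + 1) := by
    cases n with
    | zero => exact h.extZero_one_of_surjective (hN'.ext 0) hs
    | succ n => exact ExtZero.covariant₁ h (hN''.ext n) (hN'.ext (n + 1))
  have hh : IsShortExact (BimodHom.map R C f) (BimodHom.map R C g) := h.bimodHom (hext 0)
  exact ⟨hext, fun n => ExtZero.covariant₃ hh.charDual (hN'.tor n) (hN''.tor (n + 1)),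
    (hh.balancedTensor (hN''.tor 0)).bijective_left h
      (fun t => (foxbyCounit_naturality f t)) (fun t => (foxbyCounit_naturality g t).symm ▸ rfl)
      hN'.counit hN''.counit.1⟩

/-- The triangle identity makes `C ⊗` unit bijective, so the unit is onto by faithfulness. Its
kernel stays a kernel after tensoring, because `Tor₁(C, Hom_S(C, C ⊗_R M)) = 0`; hence it is killed
by `C ⊗_R -` and is zero. -/
theorem InBass.inAuslander_of_tensor (h : InBass S R C (BalancedTensor S R C M)) :
    InAuslander S R C M := by
  have hA := h.inAuslander
  have hb : Function.Bijective (BalancedTensor.map S C (foxbyUnit S R C M)) :=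
    (Function.Bijective.of_comp_iff' h.counit _).1 <| by
      convert Function.bijective_id using 1
      exact funext foxbyCounit_map_foxbyUnit
  have hs : Function.Surjective (foxbyUnit S R C M) := hC.surjective_of_tensor hb.2
  have hunit : Function.Bijective (foxbyUnit S R C M) := by
    refine ⟨?_, hs⟩
    rw [← LinearMap.ker_eq_bot, ← Submodule.subsingleton_iff_eq_bot]
    have hk := (IsShortExact.ker hs).balancedTensor (S := S) (C := C) (hA.tor 0)
    refine hC.subsingleton_of_tensor (subsingleton_of_forall_eq 0 fun t => hk.injective (hb.1 ?_))
    rw [map_zero, map_zero]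
    exact hk.exact.apply_apply_eq_zero t
  exact ⟨fun n => (hA.tor n).congr_right (CharDual.congr (LinearEquiv.ofBijective _ hunit)),
    h.ext, hunit⟩

/-- Dually, `Hom_S(C, -)` makes the counit bijective, so the counit is injective; its cokernel is
killed by `Hom_S(C, -)` because `Ext¹(C, C ⊗_R Hom_S(C, N)) = 0`. -/
theorem InAuslander.inBass_of_hom (h : InAuslander S R C (BimodHom S R C N)) :
    InBass S R C N := by
  have hB := h.inBass
  have hb : Function.Bijective (BimodHom.map R C (foxbyCounit S R C N)) :=
    (Function.Bijective.of_comp_iff _ h.unit).1 Function.bijective_id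
  have hi : Function.Injective (foxbyCounit S R C N) := hC.injective_of_hom hb.1
  have hcounit : Function.Bijective (foxbyCounit S R C N) := by
    refine ⟨hi, ?_⟩
    rw [← LinearMap.range_eq_top, ← Submodule.Quotient.subsingleton_iff]
    have hk := (IsShortExact.quotient hi).bimodHom (R := R) (C := C) (hB.ext 0)
    refine hC.subsingleton_of_hom (subsingleton_of_forall_eq 0 fun φ => ?_)
    obtain ⟨φ, rfl⟩ := hk.surjective φ
    obtain ⟨φ, rfl⟩ := hb.2 φ
    exact hk.exact.apply_apply_eq_zero φ
  exact ⟨fun n => (hB.ext n).congr_right (LinearEquiv.ofBijective _ hcounit), h.tor, hcounit⟩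

end Faithful

end FoxbyClasses

/-! ### Dualizable modules and evaluation maps -/

noncomputable section Dualizable

section Generic

variable {A B C : Type u} [Ring A] [Ring B] [AddCommGroup C] [Module A C] [Module B C]
  [SMulCommClass A B C]

variable {X Y Z : Type u} [AddCommGroup X] [Module A X] [AddCommGroup Y] [Module A Y]
  [AddCommGroup Z] [Module A Z]

variable (B C) in
/-- Precomposition with `g`, as a `B`-linear map `Hom_A(Y, C) → Hom_A(X, C)`. -/
def dualMap (g : X →ₗ[A] Y) : (Y →ₗ[A] C) →ₗ[B] (X →ₗ[A] C) where
  toFun φ := φ ∘ₗ g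
  map_add' _ _ := rfl
  map_smul' _ _ := rfl

@[simp] theorem dualMap_apply (g : X →ₗ[A] Y) (φ : Y →ₗ[A] C) (x : X) :
    dualMap B C g φ x = φ (g x) := rfl

theorem IsShortExact.dualMap {f : X →ₗ[A] Y} {g : Y →ₗ[A] Z} (h : IsShortExact f g)
    (hZ : ExtZero A Z C 1) : IsShortExact (dualMap B C g) (dualMap B C f) := by
  refine ⟨fun φ ψ hφ => LinearMap.ext fun z => ?_, fun φ => ⟨h.exists_desc φ, ?_⟩,
    hZ.exists_extension h⟩
  · obtain ⟨y, rfl⟩ := h.surjective z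
    exact LinearMap.congr_fun hφ y
  · rintro ⟨ψ, rfl⟩
    refine LinearMap.ext fun x => ?_
    rw [dualMap_apply, dualMap_apply, h.exact.apply_apply_eq_zero, map_zero]
    rfl

variable (A B C) in
/-- Super finitely presented modules `K` with `Ext^i(K, C) = 0` for `i ≥ 1` whose dual
`Hom_A(K, C)` is super finitely presented. -/
structure IsDualizable (K : Type u) [AddCommGroup K] [Module A K] : Prop where
  superFP : SuperFP A K
  ext : ∀ n, ExtZero A K C (n + 1)
  dual : SuperFP B (K →ₗ[A] C)

variable {K : Type u} [AddCommGroup K] [Module A K]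

/-- Since `Ext¹(K, C) = 0`, dualizing `0 → K' → Aⁿ → K → 0` gives `0 → K* → Cⁿ → K'* → 0`, so the
dual of the syzygy is a cokernel of super finitely presented modules. -/
theorem IsDualizable.exists_presentation (hC : SuperFP B C) (hK : IsDualizable A B C K) :
    ∃ (n : ℕ) (g : (Fin n → A) →ₗ[A] K), Function.Surjective g ∧
      IsDualizable A B C (LinearMap.ker g) := by
  obtain ⟨n, g, hg, hk⟩ := hK.superFP.exists_free_presentation
  have h := IsShortExact.ker hg
  refine ⟨n, g, hg, hk, fun i => ?_, ?_⟩
  · exact ExtZero.contravariant₁ h (.of_projective i) (hK.ext (i + 1))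
  · exact SuperFP.of_cokernel (h.dualMap (hK.ext 0)) hK.dual
      ((hC.pi n).congr ((Pi.basisFun A (Fin n)).constr B))

/-- Dimension shifting inside the dualizable modules: only `Ext¹` has to be treated, but for the
whole class. -/
theorem IsDualizable.extZero {N : Type u} [AddCommGroup N] [Module A N] (hC : SuperFP B C)
    (h : ∀ (K : Type u) [AddCommGroup K] [Module A K], IsDualizable A B C K → ExtZero A K N 1)
    (hK : IsDualizable A B C K) (n : ℕ) : ExtZero A K N (n + 1) := by
  induction n generalizing K with
  | zero => exact h K hK
  | succ n ih =>
    obtain ⟨m, g, hg, hk⟩ := hK.exists_presentation hC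
    exact ExtZero.contravariant₃ (IsShortExact.ker hg) (ih hk) (.of_projective _)

variable (A B C) in
/-- The linear map `x ↦ x i • c`, as a `B`-linear function of `c`. -/
def coordSMul {n : ℕ} (i : Fin n) : C →ₗ[B] ((Fin n → A) →ₗ[A] C) where
  toFun c := (LinearMap.toSpanSingleton A C c) ∘ₗ LinearMap.proj i
  map_add' c d := LinearMap.ext fun x => smul_add (x i) c d
  map_smul' b c := LinearMap.ext fun x => smul_comm (x i) b c

theorem sum_smul_single {N : Type*} [AddCommGroup N] [Module A N] {n : ℕ}
    (h : (Fin n → A) →ₗ[A] N) (x : Fin n → A) : ∑ i, x i • h (Pi.single i 1) = h x := by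
  have := congrArg h ((Pi.basisFun A (Fin n)).sum_repr x)
  simpa only [map_sum, map_smul, Pi.basisFun_repr, Pi.basisFun_apply] using this

theorem sum_coordSMul {n : ℕ} (φ : (Fin n → A) →ₗ[A] C) :
    ∑ i, coordSMul A B C i (φ (Pi.single i 1)) = φ := by
  refine LinearMap.ext fun x => ?_
  rw [LinearMap.sum_apply, ← sum_smul_single φ x]
  rfl

variable (A B C) in
theorem IsDualizable.self (hA : SuperFP A C) (hext : ∀ n, ExtZero A C C (n + 1))
    (hB : Function.Bijective fun b : B =>
      ({ toFun := fun c => b • c, map_add' := smul_add b,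
         map_smul' := fun a c => (smul_comm a b c).symm } : C →ₗ[A] C)) : IsDualizable A B C C := by
  refine ⟨hA, hext, SuperFP.congr (M := B) .of_finite_projective (LinearEquiv.ofBijective
    { toFun := fun b =>
        { toFun := fun c => b • c
          map_add' := smul_add b
          map_smul' := fun a c => (smul_comm a b c).symm }
      map_add' := fun b b' => LinearMap.ext fun c => add_smul b b' c
      map_smul' := fun b b' => LinearMap.ext fun c => mul_smul b b' c } hB)⟩

end Generic

variable {S R C : Type u} [Ring S] [Ring R] [AddCommGroup C] [Module S C] [Module Rᵐᵒᵖ C]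
  [SMulCommClass S Rᵐᵒᵖ C]

section WeakFlat

variable {M : Type u} [AddCommGroup M] [Module R M] {K L : Type u} [AddCommGroup K] [Module S K]
  [AddCommGroup L] [Module S L]

variable (S R C M K) in
/-- The evaluation map `Hom_S(K, C) ⊗_R M → Hom_S(K, C ⊗_R M)`. -/
def tensorEval : BalancedTensor ℤ R (K →ₗ[S] C) M →+ (K →ₗ[S] BalancedTensor S R C M) :=
  BalancedTensor.liftAddHom ℤ
    (AddMonoidHom.mk' (fun φ => AddMonoidHom.mk'
        (fun m => (show C →ₗ[S] BalancedTensor S R C M from foxbyUnit S R C M m) ∘ₗ φ)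
        fun m n => by rw [map_add]; rfl)
      fun φ ψ => AddMonoidHom.ext fun m => LinearMap.ext fun k =>
        BalancedTensor.add_tmul (φ k) (ψ k) m)
    fun φ r m => LinearMap.ext fun k => BalancedTensor.op_smul_tmul r (φ k) m

theorem tensorEval_naturality (g : K →ₗ[S] L) (t : BalancedTensor ℤ R (L →ₗ[S] C) M) :
    tensorEval S R C M K (balancedTensorMap M (dualMap Rᵐᵒᵖ C g) t) =
      tensorEval S R C M L t ∘ₗ g := by
  induction t using BalancedTensor.induction with
  | h₀ => simp
  | h φ m => rfl
  | hadd x y hx hy => rw [map_add, map_add, map_add, hx, hy, LinearMap.add_comp]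

theorem tensorEval_free_bijective (n : ℕ) :
    Function.Bijective (tensorEval S R C M (Fin n → S)) := by
  let j (i : Fin n) : BalancedTensor S R C M →+ BalancedTensor ℤ R ((Fin n → S) →ₗ[S] C) M :=
    BalancedTensor.liftAddHom S
      (AddMonoidHom.mk' (fun c => AddMonoidHom.mk'
          (fun m => .tmul ℤ R (coordSMul S Rᵐᵒᵖ C i c) m)
          fun m m' => BalancedTensor.tmul_add _ m m')
        fun c d => AddMonoidHom.ext fun m => by
          change BalancedTensor.tmul ℤ R (coordSMul S Rᵐᵒᵖ C i (c + d)) m = _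
          rw [map_add, BalancedTensor.add_tmul]; rfl)
      fun c r m => by
        change BalancedTensor.tmul ℤ R (coordSMul S Rᵐᵒᵖ C i (op r • c)) m = _
        rw [map_smul, BalancedTensor.op_smul_tmul]; rfl
  have hj (i) (t) (x : Fin n → S) : tensorEval S R C M (Fin n → S) (j i t) x = x i • t := by
    induction t using BalancedTensor.induction with
    | h₀ => simp
    | h c m => rfl
    | hadd t t' ht ht' => rw [map_add, map_add, LinearMap.add_apply, ht, ht', smul_add]
  -- `j i` inserts `C ⊗_R M` as the `i`-th summand of `Hom_S(Sⁿ, C) ⊗_R M ≅ (C ⊗_R M)ⁿ`.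
  let inv (h : (Fin n → S) →ₗ[S] BalancedTensor S R C M) := ∑ i, j i (h (Pi.single i 1))
  refine Function.bijective_iff_has_inverse.2 ⟨inv, fun t => ?_, fun h => ?_⟩
  · induction t using BalancedTensor.induction with
    | h₀ => simp [inv]
    | h φ m =>
      have hsum : ∑ i, BalancedTensor.tmul ℤ R (coordSMul S Rᵐᵒᵖ C i (φ (Pi.single i 1))) m =
          BalancedTensor.tmul ℤ R (∑ i, coordSMul S Rᵐᵒᵖ C i (φ (Pi.single i 1))) m :=
        (map_sum (AddMonoidHom.mk' (fun ψ => BalancedTensor.tmul ℤ R ψ m)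
          fun ψ ψ' => BalancedTensor.add_tmul ψ ψ' m) _ _).symm
      rw [sum_coordSMul] at hsum
      exact hsum
    | hadd x y hx hy =>
      simp only [inv, map_add, LinearMap.add_apply, Finset.sum_add_distrib] at hx hy ⊢
      rw [hx, hy]
  · refine LinearMap.ext fun x => ?_
    simp only [inv, map_sum, LinearMap.sum_apply, hj]
    exact sum_smul_single h x

variable (hC : SuperFP Rᵐᵒᵖ C) (hM : WeakFlatDimLE R 0 M)
include hC hM

/-- For the syzygy `K'`, `Tor₁(K'*, M) = 0` embeds `K* ⊗_R M` in `(Sⁿ)* ⊗_R M`, where evaluation is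
bijective. -/
theorem IsDualizable.tensorEval_injective (hK : IsDualizable S Rᵐᵒᵖ C K) :
    Function.Injective (tensorEval S R C M K) := by
  obtain ⟨n, g, hg, hk⟩ := hK.exists_presentation hC
  have h := (IsShortExact.ker hg).dualMap (B := Rᵐᵒᵖ) (hK.ext 0)
  have hi : Function.Injective (balancedTensorMap M (dualMap Rᵐᵒᵖ C g)) :=
    balancedTensorMap_injective_iff.2 (ExtZero.exists_extension h (hM _ hk.dual))
  intro t t' htt
  refine hi ((tensorEval_free_bijective n).1 ?_)
  rw [tensorEval_naturality, tensorEval_naturality, htt]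

theorem IsDualizable.tensorEval_bijective (hK : IsDualizable S Rᵐᵒᵖ C K) :
    Function.Bijective (tensorEval S R C M K) := by
  refine ⟨hK.tensorEval_injective hC hM, fun k => ?_⟩
  obtain ⟨n, g, hg, hk⟩ := hK.exists_presentation hC
  have h := (IsShortExact.ker hg).dualMap (B := Rᵐᵒᵖ) (hK.ext 0)
  obtain ⟨t, ht⟩ := (tensorEval_free_bijective n).2 (k ∘ₗ g)
  -- The preimage `t` of `k ∘ g` dies in `K'* ⊗_R M`, since evaluation is injective for the syzygy
  -- too, and so comes from `K* ⊗_R M`.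
  obtain ⟨s, rfl⟩ := (h.balancedTensorMap_exact t).1 (hk.tensorEval_injective hC hM (by
    rw [tensorEval_naturality, ht, map_zero, LinearMap.comp_assoc,
      (IsShortExact.ker hg).comp_eq_zero, LinearMap.comp_zero]))
  rw [tensorEval_naturality] at ht
  exact ⟨s, (LinearMap.cancel_right hg).1 ht⟩

/-- A map `K' → C ⊗_R M` is an element of `K'* ⊗_R M`, which lifts to `(Sⁿ)* ⊗_R M` by right
exactness; the lift evaluates to an extension of the map to `Sⁿ`. -/
theorem IsDualizable.extZero_tensor_one (hK : IsDualizable S Rᵐᵒᵖ C K) :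
    ExtZero S K (BalancedTensor S R C M) 1 := by
  obtain ⟨n, g, hg, hk⟩ := hK.exists_presentation hC
  have h := (IsShortExact.ker hg).dualMap (B := Rᵐᵒᵖ) (hK.ext 0)
  refine ExtZero.one_of_forall_extension (IsShortExact.ker hg) (.of_projective 0) fun k => ?_
  obtain ⟨t, rfl⟩ := (hk.tensorEval_bijective hC hM).2 k
  obtain ⟨s, rfl⟩ := balancedTensorMap_surjective h.surjective t
  exact ⟨_, (tensorEval_naturality _ s).symm⟩

end WeakFlat

/-! ### Evaluation for weak injective modules -/

section WeakInjective

instance : SMulCommClass Rᵐᵒᵖ S C := SMulCommClass.symm _ _ _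

variable {N : Type u} [AddCommGroup N] [Module S N] {K L : Type u} [AddCommGroup K] [Module Rᵐᵒᵖ K]
  [AddCommGroup L] [Module Rᵐᵒᵖ L]

variable (S R C N K) in
/-- The evaluation map `K ⊗_R Hom_S(C, N) → Hom_S(Hom_{Rᵒᵖ}(K, C), N)`. -/
def homEval : BalancedTensor ℤ R K (BimodHom S R C N) →+ ((K →ₗ[Rᵐᵒᵖ] C) →ₗ[S] N) :=
  BalancedTensor.liftAddHom ℤ
    (AddMonoidHom.mk' (fun k => AddMonoidHom.mk'
        (fun f : BimodHom S R C N => ({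
          toFun := fun φ => f (φ k)
          map_add' := fun φ ψ => map_add f _ _
          map_smul' := fun s φ => map_smul f s _ } : (K →ₗ[Rᵐᵒᵖ] C) →ₗ[S] N))
        fun _ _ => rfl)
      fun k l => AddMonoidHom.ext fun f => LinearMap.ext fun φ => by
        change f (φ (k + l)) = f (φ k) + f (φ l)
        rw [map_add, map_add])
    fun k r f => LinearMap.ext fun φ => congrArg f (φ.map_smul (op r) k)

theorem homEval_naturality (g : K →ₗ[Rᵐᵒᵖ] L) (t : BalancedTensor ℤ R K (BimodHom S R C N)) :
    homEval S R C N L (balancedTensorMap _ g t) = homEval S R C N K t ∘ₗ dualMap S C g := by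
  induction t using BalancedTensor.induction with
  | h₀ => simp
  | h φ m => rfl
  | hadd x y hx hy => rw [map_add, map_add, map_add, hx, hy, LinearMap.add_comp]

theorem homEval_free_bijective (n : ℕ) :
    Function.Bijective (homEval S R C N (Fin n → Rᵐᵒᵖ)) := by
  let pre (i : Fin n) (h : ((Fin n → Rᵐᵒᵖ) →ₗ[Rᵐᵒᵖ] C) →ₗ[S] N) : BimodHom S R C N :=
    show C →ₗ[S] N from h ∘ₗ coordSMul Rᵐᵒᵖ S C i
  let inv (h : ((Fin n → Rᵐᵒᵖ) →ₗ[Rᵐᵒᵖ] C) →ₗ[S] N) :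
      BalancedTensor ℤ R (Fin n → Rᵐᵒᵖ) (BimodHom S R C N) :=
    ∑ i, .tmul ℤ R (Pi.single i 1) (pre i h)
  have hadd (h h') : inv (h + h') = inv h + inv h' :=
    Eq.trans (Finset.sum_congr rfl fun i _ => BalancedTensor.tmul_add _ (pre i h) (pre i h'))
      Finset.sum_add_distrib
  refine Function.bijective_iff_has_inverse.2 ⟨inv, fun t => ?_, fun h => ?_⟩
  · induction t using BalancedTensor.induction with
    | h₀ =>
      refine Finset.sum_eq_zero fun i _ => ?_
      rw [map_zero]
      exact congrArg Submodule.Quotient.mk (TensorProduct.tmul_zero _ _)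
    | h k f =>
      have hterm (i : Fin n) : BalancedTensor.tmul ℤ R (Pi.single i (1 : Rᵐᵒᵖ))
          (pre i (homEval S R C N _ (.tmul ℤ R k f))) =
            BalancedTensor.tmul ℤ R (k i • Pi.single i (1 : Rᵐᵒᵖ)) f :=
        (BalancedTensor.op_smul_tmul (unop (k i)) _ f).symm
      have hsum : ∑ i, BalancedTensor.tmul ℤ R (k i • Pi.single i (1 : Rᵐᵒᵖ)) f =
          BalancedTensor.tmul ℤ R (∑ i, k i • Pi.single i (1 : Rᵐᵒᵖ)) f :=
        (map_sum (AddMonoidHom.mk' (fun ψ => BalancedTensor.tmul ℤ R ψ f)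
          fun ψ ψ' => BalancedTensor.add_tmul ψ ψ' f) _ _).symm
      have hk : ∑ i, k i • Pi.single i (1 : Rᵐᵒᵖ) = k := sum_smul_single LinearMap.id k
      rw [hk] at hsum
      exact (Finset.sum_congr rfl fun i _ => hterm i).trans hsum
    | hadd x y hx hy =>
      rw [map_add, hadd, hx, hy]
  · refine LinearMap.ext fun φ => ?_
    simp only [inv, map_sum, LinearMap.sum_apply]
    refine Eq.trans ?_ (congrArg h (sum_coordSMul (B := S) φ))
    rw [map_sum]
    rfl

variable (hC : SuperFP S C) (hN : WeakInjDimLE S 0 N)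
include hC hN

/-- As `Ext¹(K'*, N) = 0` for the syzygy `K'`, a map `K* → N` extends to the dual of the free
module, where evaluation is bijective. -/
theorem IsDualizable.homEval_surjective (hK : IsDualizable Rᵐᵒᵖ S C K) :
    Function.Surjective (homEval S R C N K) := fun k => by
  obtain ⟨n, g, hg, hk⟩ := hK.exists_presentation hC
  have h := (IsShortExact.ker hg).dualMap (B := S) (hK.ext 0)
  obtain ⟨k', rfl⟩ := ExtZero.exists_extension h (hN _ hk.dual) k
  obtain ⟨t, rfl⟩ := (homEval_free_bijective n).2 k'
  exact ⟨_, homEval_naturality g t⟩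

theorem IsDualizable.homEval_bijective (hK : IsDualizable Rᵐᵒᵖ S C K) :
    Function.Bijective (homEval S R C N K) := by
  refine ⟨(injective_iff_map_eq_zero _).2 fun y hy => ?_, hK.homEval_surjective hC hN⟩
  obtain ⟨n, g, hg, hk⟩ := hK.exists_presentation hC
  have h := (IsShortExact.ker hg).dualMap (B := S) (hK.ext 0)
  obtain ⟨t, rfl⟩ := balancedTensorMap_surjective hg y
  rw [homEval_naturality] at hy
  -- The evaluation of `t` vanishes on `K*` and descends to `K'*`. Surjectivity for the syzygy then
  -- shows that `t` comes from `K'`, so its image `y` is zero.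
  obtain ⟨l, hl⟩ := h.exists_desc _ hy
  obtain ⟨s, rfl⟩ := hk.homEval_surjective hC hN l
  rw [← homEval_naturality] at hl
  rw [← (homEval_free_bijective n).1 hl]
  exact (IsShortExact.ker hg).balancedTensorMap_exact.apply_apply_eq_zero s

/-- By duality the claim is that tensoring `K' → Rⁿ` with `Hom_S(C, N)` stays injective. Under
evaluation this becomes precomposition with the surjection `(Rⁿ)* → K'*`. -/
theorem IsDualizable.extZero_charDual_hom_one (hK : IsDualizable Rᵐᵒᵖ S C K) :
    ExtZero Rᵐᵒᵖ K (CharDual R (BimodHom S R C N)) 1 := by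
  obtain ⟨n, g, hg, hk⟩ := hK.exists_presentation hC
  have h := (IsShortExact.ker hg).dualMap (B := S) (hK.ext 0)
  refine ExtZero.one_of_forall_extension (IsShortExact.ker hg) (.of_projective 0)
    (balancedTensorMap_injective_iff.1 fun s s' hs => (hk.homEval_bijective hC hN).1 ?_)
  have := congrArg (homEval S R C N _) hs
  rw [homEval_naturality, homEval_naturality] at this
  exact (LinearMap.cancel_right h.surjective).1 this

end WeakInjective

/-! ### Weak flat modules are Auslander, weak injective modules are Bass -/

section Semidualizing

variable (hC : IsSemidualizing S R C)
include hC

theorem IsSemidualizing.isDualizable_left : IsDualizable S Rᵐᵒᵖ C C :=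
  .self S Rᵐᵒᵖ C hC.finite_left (fun n => hC.ext_left (n + 1) (Nat.le_add_left 1 n)) <|
    hC.homothety_right.comp unop_bijective

theorem IsSemidualizing.isDualizable_right : IsDualizable Rᵐᵒᵖ S C C :=
  .self Rᵐᵒᵖ S C hC.finite_right (fun n => hC.ext_right (n + 1) (Nat.le_add_left 1 n))
    hC.homothety_left

theorem IsSemidualizing.inAuslander_of_weakFlat {M : Type u} [AddCommGroup M] [Module R M]
    (hM : WeakFlatDimLE R 0 M) : InAuslander S R C M := by
  refine ⟨fun n => hM.mono (Nat.zero_le n) _ hC.finite_right, fun n =>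
    hC.isDualizable_left.extZero hC.finite_right (fun K _ _ hK =>
      hK.extZero_tensor_one hC.finite_right hM) n, ?_⟩
  let e := Equiv.ofBijective _ hC.homothety_right
  have he (r : R) : (e r : C →ₗ[S] C) = rightHomothety C r := rfl
  -- Through `Hom_S(C, C) ≅ R` this is a left inverse of `m ↦ id ⊗ m`.
  let v : BalancedTensor ℤ R (C →ₗ[S] C) M →+ M :=
    BalancedTensor.liftAddHom ℤ
      (AddMonoidHom.mk' (fun φ => AddMonoidHom.mk' (fun m => e.symm φ • m) fun m n => smul_add _ m n)
        fun φ ψ => AddMonoidHom.ext fun m => by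
          change e.symm (φ + ψ) • m = e.symm φ • m + e.symm ψ • m
          rw [← add_smul]
          congr 1
          obtain ⟨r, rfl⟩ := e.surjective φ
          obtain ⟨s, rfl⟩ := e.surjective ψ
          rw [e.symm_apply_apply, e.symm_apply_apply, Equiv.symm_apply_eq]
          exact LinearMap.ext fun c => (add_smul (op r) (op s) c).symm)
      fun φ r m => by
        change e.symm (op r • φ) • m = e.symm φ • r • m
        rw [← mul_smul]
        congr 1
        obtain ⟨s, rfl⟩ := e.surjective φ
        rw [e.symm_apply_apply, Equiv.symm_apply_eq]
        exact LinearMap.ext fun c => (mul_smul (op r) (op s) c).symm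
  have hv : Function.Bijective fun m : M => BalancedTensor.tmul ℤ R (LinearMap.id : C →ₗ[S] C) m := by
    have h1 : e 1 = LinearMap.id := LinearMap.ext fun c => one_smul _ c
    constructor
    · refine Function.LeftInverse.injective (g := v) fun m => ?_
      change e.symm LinearMap.id • m = m
      rw [← h1, e.symm_apply_apply, one_smul]
    · intro t
      induction t using BalancedTensor.induction with
      | h₀ => exact ⟨0, congrArg Submodule.Quotient.mk (TensorProduct.tmul_zero _ _)⟩
      | h φ m =>
        obtain ⟨r, rfl⟩ := e.surjective φ
        exact ⟨r • m, (BalancedTensor.op_smul_tmul r LinearMap.id m).symm⟩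
      | hadd x y hx hy =>
        obtain ⟨x, rfl⟩ := hx
        obtain ⟨y, rfl⟩ := hy
        exact ⟨x + y, BalancedTensor.tmul_add _ x y⟩
  -- The unit is `m ↦ id ⊗ m` followed by evaluation at `K = C`.
  exact (hC.isDualizable_left.tensorEval_bijective hC.finite_right hM).comp hv

theorem IsSemidualizing.inBass_of_weakInjective {N : Type u} [AddCommGroup N] [Module S N]
    (hN : WeakInjDimLE S 0 N) : InBass S R C N := by
  refine ⟨fun n => hN.mono (Nat.zero_le n) _ hC.finite_left, fun n =>
    hC.isDualizable_right.extZero hC.finite_left (fun K _ _ hK =>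
      hK.extZero_charDual_hom_one hC.finite_left hN) n, ?_⟩
  -- Under `Hom(C, C) ≅ S` this is the evaluation `Hom_S(S, N) ≅ N` at `1`.
  have hev : Function.Bijective fun h : (C →ₗ[Rᵐᵒᵖ] C) →ₗ[S] N => h LinearMap.id := by
    have hs (s : S) : leftHomothety (R := R) C s = s • (LinearMap.id : C →ₗ[Rᵐᵒᵖ] C) := rfl
    constructor
    · intro h h' hh
      refine LinearMap.ext fun φ => ?_
      obtain ⟨s, rfl⟩ := hC.homothety_left.2 φ
      change h (leftHomothety C s) = h' (leftHomothety C s)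
      rw [hs, map_smul, map_smul]
      exact congrArg (s • ·) hh
    · intro x
      let e : S ≃ₗ[S] (C →ₗ[Rᵐᵒᵖ] C) := LinearEquiv.ofBijective
        { toFun := fun s => leftHomothety C s
          map_add' := fun s t => LinearMap.ext fun c => add_smul s t c
          map_smul' := fun s t => LinearMap.ext fun c => mul_smul s t c } hC.homothety_left
      refine ⟨LinearMap.toSpanSingleton S N x ∘ₗ e.symm.toLinearMap, ?_⟩
      have : e.symm LinearMap.id = 1 := (LinearEquiv.symm_apply_eq _).2
        (LinearMap.ext fun c => (one_smul S c).symm)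
      change e.symm LinearMap.id • x = x
      rw [this, one_smul]
  -- The evaluation map is defined on the tensor product over `R` formed with `ℤ`, the counit on the
  -- one formed with `S`. The comparison `b` is visibly onto, and injective because its composite
  -- with the counit is.
  let b : BalancedTensor ℤ R C (BimodHom S R C N) →+ BalancedTensor S R C (BimodHom S R C N) :=
    BalancedTensor.liftAddHom ℤ
      (AddMonoidHom.mk' (fun c => AddMonoidHom.mk' (fun f => .tmul S R c f)
        fun f g => BalancedTensor.tmul_add c f g)
        fun c d => AddMonoidHom.ext fun f => BalancedTensor.add_tmul c d f)
      fun c r f => BalancedTensor.op_smul_tmul r c f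
  have hb : Function.Surjective b := fun t => by
    induction t using BalancedTensor.induction with
    | h₀ => exact ⟨0, map_zero _⟩
    | h c f => exact ⟨.tmul ℤ R c f, rfl⟩
    | hadd x y hx hy =>
      obtain ⟨x, rfl⟩ := hx
      obtain ⟨y, rfl⟩ := hy
      exact ⟨x + y, map_add _ _ _⟩
  have hcomp : Function.Bijective (foxbyCounit S R C N ∘ b) := by
    convert hev.comp (hC.isDualizable_right.homEval_bijective hC.finite_left hN) using 1
    funext t
    induction t using BalancedTensor.induction with
    | h₀ => simp
    | h c f => rfl
    | hadd x y hx hy =>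
      simp only [Function.comp_apply, map_add, LinearMap.add_apply] at hx hy ⊢
      rw [hx, hy]
  exact (Function.Bijective.of_comp_iff _ ⟨hcomp.1.of_comp, hb⟩).1 hcomp

end Semidualizing

end Dualizable

/-! ### Resolutions, coresolutions and the comparison of dimensions -/

noncomputable section Resolutions

variable {S R C : Type u} [Ring S] [Ring R] [AddCommGroup C] [Module S C] [Module Rᵐᵒᵖ C]

instance BalancedTensor.subsingleton {M : Type*} [AddCommGroup M] [Module R M] [Subsingleton M] :
    Subsingleton (BalancedTensor S R C M) := by
  refine subsingleton_of_forall_eq 0 fun t => ?_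
  induction t using BalancedTensor.induction with
  | h₀ => rfl
  | h c m =>
    rw [Subsingleton.elim m 0]
    exact congrArg Submodule.Quotient.mk (TensorProduct.tmul_zero M c)
  | hadd x y hx hy => rw [hx, hy, add_zero]

theorem hasCWeakFlatResolution_zero_iff {N : ModuleCat.{u} S} :
    HasCWeakFlatResolution S R C 0 N ↔ ∃ (F : ModuleCat.{u} R) (ε : foxbyTensor S C F →ₗ[S] N),
      WeakFlatDimLE R 0 F ∧ Function.Bijective ε := by
  constructor
  · rintro ⟨F, d, ε, hF, hF', hε, h₀, -⟩
    refine ⟨F 0, ε, (isWeakFlat_iff _).1 (hF 0 le_rfl),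
      (injective_iff_map_eq_zero ε).2 fun x hx => ?_, hε⟩
    obtain ⟨y, rfl⟩ := (h₀ x).1 hx
    have := hF' 1 one_pos
    rw [Subsingleton.elim y 0, map_zero]
  · rintro ⟨F, ε, hF, hε⟩
    let G : ℕ → ModuleCat.{u} R := fun
      | 0 => F
      | _ + 1 => ModuleCat.of R PUnit
    have hG (i) : Subsingleton (G (i + 1)) := inferInstanceAs (Subsingleton PUnit)
    refine ⟨G, fun _ => 0, ε, fun i hi => ?_, fun i hi => ?_, hε.2, fun x => ?_, fun i x => ?_⟩
    · obtain rfl := Nat.le_zero.1 hi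
      exact (isWeakFlat_iff _).2 hF
    · obtain ⟨i, rfl⟩ := Nat.exists_eq_succ_of_ne_zero hi.ne'
      exact hG i
    · exact ⟨fun hx => ⟨0, (hε.1 (hx.trans (map_zero ε).symm)).symm⟩, by
        rintro ⟨y, rfl⟩; exact map_zero ε⟩
    · have := hG i
      exact ⟨fun _ => ⟨0, Subsingleton.elim (α := BalancedTensor S R C (G (i + 1))) _ _⟩,
        fun _ => rfl⟩

theorem hasCWeakFlatResolution_succ_iff {N : ModuleCat.{u} S} {n : ℕ} :
    HasCWeakFlatResolution S R C (n + 1) N ↔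
      ∃ (F : ModuleCat.{u} R) (ε : foxbyTensor S C F →ₗ[S] N), WeakFlatDimLE R 0 F ∧
        Function.Surjective ε ∧
        HasCWeakFlatResolution S R C n (ModuleCat.of S (LinearMap.ker ε)) := by
  constructor
  · rintro ⟨F, d, ε, hF, hF', hε, h₀, hd⟩
    refine ⟨F 0, ε, (isWeakFlat_iff _).1 (hF 0 (Nat.zero_le _)), hε, fun i => F (i + 1),
      fun i => d (i + 1), (d 0).codRestrict _ h₀.apply_apply_eq_zero,
      fun i hi => hF _ (Nat.succ_le_succ hi), fun i hi => hF' _ (Nat.succ_lt_succ hi), ?_, ?_,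
      fun i => hd (i + 1)⟩
    · rintro ⟨x, hx⟩
      obtain ⟨y, rfl⟩ := (h₀ x).1 hx
      exact ⟨y, rfl⟩
    · intro x
      rw [← hd 0 x]
      exact Subtype.ext_iff
  · rintro ⟨F, ε, hF, hε, G, d, ε', hG, hG', hε', h₀, hd⟩
    let F' : ℕ → ModuleCat.{u} R := fun
      | 0 => F
      | i + 1 => G i
    let d' : ∀ i, foxbyTensor S C (F' (i + 1)) →ₗ[S] foxbyTensor S C (F' i) := fun
      | 0 => (LinearMap.ker ε).subtype ∘ₗ ε'
      | i + 1 => d i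
    refine ⟨F', d', ε, fun i hi => ?_, fun i hi => ?_, hε, fun x => ⟨fun hx => ?_, ?_⟩, fun i => ?_⟩
    · cases i with
      | zero => exact (isWeakFlat_iff _).2 hF
      | succ i => exact hG i (Nat.le_of_succ_le_succ hi)
    · obtain ⟨i, rfl⟩ := Nat.exists_eq_succ_of_ne_zero (Nat.ne_zero_of_lt hi)
      exact hG' i (Nat.lt_of_succ_lt_succ hi)
    · obtain ⟨y, hy⟩ := hε' ⟨x, hx⟩
      exact ⟨y, congrArg Subtype.val hy⟩
    · rintro ⟨y, rfl⟩
      exact (ε' y).2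
    · cases i with
      | zero => exact fun x => Subtype.ext_iff.symm.trans (h₀ x)
      | succ i => exact hd i

variable [SMulCommClass S Rᵐᵒᵖ C]

instance BimodHom.subsingleton {N : Type*} [AddCommGroup N] [Module S N] [Subsingleton N] :
    Subsingleton (BimodHom S R C N) := ⟨fun _ _ => BimodHom.ext fun _ => Subsingleton.elim _ _⟩

theorem hasCWeakInjectiveCoresolution_zero_iff {M : ModuleCat.{u} R} :
    HasCWeakInjectiveCoresolution S R C 0 M ↔
      ∃ (I : ModuleCat.{u} S) (η : M →ₗ[R] foxbyHom R C I),
        WeakInjDimLE S 0 I ∧ Function.Bijective η := by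
  constructor
  · rintro ⟨I, η, d, hI, hI', hη, h₀, -⟩
    refine ⟨I 0, η, (isWeakInjective_iff _).1 (hI 0 le_rfl), hη, fun x => (h₀ x).1 ?_⟩
    have := hI' 1 one_pos
    exact Subsingleton.elim (α := BimodHom S R C (I 1)) _ _
  · rintro ⟨I, η, hI, hη⟩
    let J : ℕ → ModuleCat.{u} S := fun
      | 0 => I
      | _ + 1 => ModuleCat.of S PUnit
    have hJ (i) : Subsingleton (J (i + 1)) := inferInstanceAs (Subsingleton PUnit)
    refine ⟨J, η, fun _ => 0, fun i hi => ?_, fun i hi => ?_, hη.1, fun x => ?_, fun i x => ?_⟩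
    · obtain rfl := Nat.le_zero.1 hi
      exact (isWeakInjective_iff _).2 hI
    · obtain ⟨i, rfl⟩ := Nat.exists_eq_succ_of_ne_zero hi.ne'
      exact hJ i
    · exact ⟨fun _ => hη.2 x, fun _ => rfl⟩
    · have := hJ i
      exact ⟨fun _ => ⟨0, Subsingleton.elim (α := BimodHom S R C (J (i + 1))) _ _⟩, fun _ => rfl⟩

theorem hasCWeakInjectiveCoresolution_succ_iff {M : ModuleCat.{u} R} {n : ℕ} :
    HasCWeakInjectiveCoresolution S R C (n + 1) M ↔
      ∃ (I : ModuleCat.{u} S) (η : M →ₗ[R] foxbyHom R C I), WeakInjDimLE S 0 I ∧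
        Function.Injective η ∧
        HasCWeakInjectiveCoresolution S R C n
          (ModuleCat.of R (BimodHom S R C I ⧸ LinearMap.range η)) := by
  constructor
  · rintro ⟨I, η, d, hI, hI', hη, h₀, hd⟩
    have hker : LinearMap.range η = LinearMap.ker (d 0) := h₀.linearMap_ker_eq.symm
    refine ⟨I 0, η, (isWeakInjective_iff _).1 (hI 0 (Nat.zero_le _)), hη, fun i => I (i + 1),
      (LinearMap.range η).liftQ (d 0) hker.le, fun i => d (i + 1),
      fun i hi => hI _ (Nat.succ_le_succ hi), fun i hi => hI' _ (Nat.succ_lt_succ hi), ?_, ?_,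
      fun i => hd (i + 1)⟩
    · exact LinearMap.ker_eq_bot.1 (Submodule.ker_liftQ_eq_bot _ _ _ hker.ge)
    · intro x
      rw [hd 0 x]
      constructor
      · rintro ⟨y, rfl⟩
        exact ⟨Submodule.Quotient.mk y, rfl⟩
      · rintro ⟨y, rfl⟩
        obtain ⟨y, rfl⟩ := Submodule.mkQ_surjective _ y
        exact ⟨y, rfl⟩
  · rintro ⟨I, η, hI, hη, J, η', d, hJ, hJ', hη', h₀, hd⟩
    let I' : ℕ → ModuleCat.{u} S := fun
      | 0 => I
      | i + 1 => J i
    let d' : ∀ i, foxbyHom R C (I' i) →ₗ[R] foxbyHom R C (I' (i + 1)) := fun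
      | 0 => η' ∘ₗ (LinearMap.range η).mkQ
      | i + 1 => d i
    refine ⟨I', η, d', fun i hi => ?_, fun i hi => ?_, hη, fun x => ?_, fun i => ?_⟩
    · cases i with
      | zero => exact (isWeakInjective_iff _).2 hI
      | succ i => exact hJ i (Nat.le_of_succ_le_succ hi)
    · obtain ⟨i, rfl⟩ := Nat.exists_eq_succ_of_ne_zero (Nat.ne_zero_of_lt hi)
      exact hJ' i (Nat.lt_of_succ_lt_succ hi)
    · refine Iff.trans ?_ (LinearMap.exact_map_mkQ_range η x)
      exact map_eq_zero_iff η' hη'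
    · cases i with
      | zero =>
        intro x
        refine (h₀ x).trans ⟨?_, ?_⟩
        · rintro ⟨y, rfl⟩
          obtain ⟨y, rfl⟩ := Submodule.mkQ_surjective _ y
          exact ⟨y, rfl⟩
        · rintro ⟨y, rfl⟩
          exact ⟨(LinearMap.range η).mkQ y, rfl⟩
      | succ i => exact hd i

section

variable {M M' N N' : Type u} [AddCommGroup M] [Module R M] [AddCommGroup M'] [Module R M']
  [AddCommGroup N] [Module S N] [AddCommGroup N'] [Module S N']

variable (S C) in
/-- The isomorphism `C ⊗_R e`. -/
def BalancedTensor.congr (e : M ≃ₗ[R] M') : BalancedTensor S R C M ≃ₗ[S] BalancedTensor S R C M' :=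
  LinearEquiv.ofBijective _ (BalancedTensor.map_bijective e.bijective)

variable (R C) in
/-- The isomorphism `Hom_S(C, e)`. -/
def BimodHom.congr (e : N ≃ₗ[S] N') : BimodHom S R C N ≃ₗ[R] BimodHom S R C N' :=
  LinearEquiv.ofBijective _ (BimodHom.map_bijective e.bijective)

theorem InAuslander.congr (e : M ≃ₗ[R] M') (h : InAuslander S R C M) : InAuslander S R C M' :=
  ⟨fun n => (h.tor n).congr_right (CharDual.congr e).symm,
    fun n => (h.ext n).congr_right (BalancedTensor.congr S C e),
    (Function.Bijective.of_comp_iff _ e.bijective).1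
      ((BimodHom.congr R C (BalancedTensor.congr S C e)).bijective.comp h.unit)⟩

theorem InBass.congr (e : N ≃ₗ[S] N') (h : InBass S R C N) : InBass S R C N' :=
  ⟨fun n => (h.ext n).congr_right e,
    fun n => (h.tor n).congr_right (CharDual.congr (BimodHom.congr R C e)).symm,
    (Function.Bijective.of_comp_iff _
      (BalancedTensor.congr S C (BimodHom.congr R C e)).bijective).1 <| by
      convert e.bijective.comp h.counit using 1
      exact funext (foxbyCounit_naturality e.toLinearMap)⟩

/-- The isomorphism `M ≅ Hom_S(C, C ⊗_R M)`. -/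
def InAuslander.unitEquiv (h : InAuslander S R C M) :
    M ≃ₗ[R] BimodHom S R C (BalancedTensor S R C M) :=
  LinearEquiv.ofBijective _ h.unit

/-- The isomorphism `C ⊗_R Hom_S(C, N) ≅ N`. -/
def InBass.counitEquiv (h : InBass S R C N) : BalancedTensor S R C (BimodHom S R C N) ≃ₗ[S] N :=
  LinearEquiv.ofBijective _ h.counit

/-- Induction on the length, splitting off the first term `C ⊗_R F`. Its kernel sequence lies in the
Bass class, so `Hom_S(C, -)` keeps it exact and turns the first term into `F`. -/
theorem hasCWeakFlatResolution_iff (hC : IsFaithfullySemidualizing S R C) (N : ModuleCat.{u} S)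
    (n : ℕ) : HasCWeakFlatResolution S R C n N ↔
      InBass S R C N ∧ WeakFlatDimLE R n (BimodHom S R C N) := by
  induction n generalizing N with
  | zero =>
    rw [hasCWeakFlatResolution_zero_iff]
    constructor
    · rintro ⟨F, ε, hF, hε⟩
      have hA : InAuslander S R C F := hC.inAuslander_of_weakFlat hF
      let e : BalancedTensor S R C F ≃ₗ[S] N := LinearEquiv.ofBijective ε hε
      exact ⟨hA.inBass.congr e, hF.congr (hA.unitEquiv.trans (BimodHom.congr R C e))⟩
    · rintro ⟨hB, hF⟩
      exact ⟨foxbyHom R C N, foxbyCounit S R C N, hF, hB.counit⟩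
  | succ n ih =>
    rw [hasCWeakFlatResolution_succ_iff]
    constructor
    · rintro ⟨F, ε, hF, hε, hN⟩
      obtain ⟨hB, hd⟩ := (ih _).1 hN
      have hA : InAuslander S R C F := hC.inAuslander_of_weakFlat hF
      have hs := IsShortExact.ker hε
      refine ⟨InBass.cokernel hs hB hA.inBass, ?_⟩
      exact WeakFlatDimLE.cokernel (hs.bimodHom (hB.ext 0))
        (WeakFlatDimLE.congr hA.unitEquiv (WeakInjDimLE.mono (Nat.zero_le _) hF)) hd
    · rintro ⟨hB, hd⟩
      -- The first term is built from a free cover of `Hom_S(C, N)`: apply `C ⊗_R -` and then the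
      -- counit, which is onto.
      have hQ (n) : WeakFlatDimLE R n (BimodHom S R C N →₀ R) := .finsupp _ n
      have hA : InAuslander S R C (BimodHom S R C N →₀ R) := hC.inAuslander_of_weakFlat (hQ 0)
      let ε : BalancedTensor S R C (BimodHom S R C N →₀ R) →ₗ[S] N := foxbyCounit S R C N ∘ₗ
        BalancedTensor.map S C (Finsupp.linearCombination R id)
      have hε : Function.Surjective ε := hB.counit.2.comp
        (BalancedTensor.map_surjective (Finsupp.linearCombination_id_surjective R _))
      have hs := IsShortExact.ker hε
      have hk : InBass S R C (LinearMap.ker ε) := InBass.kernel hC hs hA.inBass hB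
      exact ⟨ModuleCat.of R (BimodHom S R C N →₀ R), ε, hQ 0, hε, (ih _).2 ⟨hk,
        WeakFlatDimLE.kernel (hs.bimodHom (hk.ext 0)) ((hQ n).congr hA.unitEquiv) hd⟩⟩

theorem exists_injective_embedding (N : Type u) [AddCommGroup N] [Module S N] :
    ∃ (I : ModuleCat.{u} S) (j : N →ₗ[S] I), Injective I ∧ Function.Injective j :=
  ⟨Injective.under (ModuleCat.of S N), (Injective.ι (ModuleCat.of S N)).hom, inferInstance,
    (ModuleCat.mono_iff_injective _).1 inferInstance⟩

theorem hasCWeakInjectiveCoresolution_iff (hC : IsFaithfullySemidualizing S R C)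
    (M : ModuleCat.{u} R) (n : ℕ) : HasCWeakInjectiveCoresolution S R C n M ↔
      InAuslander S R C M ∧ WeakInjDimLE S n (BalancedTensor S R C M) := by
  induction n generalizing M with
  | zero =>
    rw [hasCWeakInjectiveCoresolution_zero_iff]
    constructor
    · rintro ⟨I, η, hI, hη⟩
      have hB : InBass S R C I := hC.inBass_of_weakInjective hI
      let e : M ≃ₗ[R] BimodHom S R C I := LinearEquiv.ofBijective η hη
      exact ⟨hB.inAuslander.congr e.symm,
        hI.congr (hB.counitEquiv.symm.trans (BalancedTensor.congr S C e.symm))⟩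
    · rintro ⟨hA, hI⟩
      exact ⟨foxbyTensor S C M, foxbyUnit S R C M, hI, hA.unit⟩
  | succ n ih =>
    rw [hasCWeakInjectiveCoresolution_succ_iff]
    constructor
    · rintro ⟨I, η, hI, hη, hM⟩
      obtain ⟨hA, hd⟩ := (ih _).1 hM
      have hB : InBass S R C I := hC.inBass_of_weakInjective hI
      have hs := IsShortExact.quotient hη
      exact ⟨InAuslander.kernel hs hB.inAuslander hA,
        WeakInjDimLE.kernel (hs.balancedTensor (hA.tor 0))
          (WeakInjDimLE.congr hB.counitEquiv.symm (hI.mono (Nat.zero_le _))) hd⟩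
    · rintro ⟨hA, hd⟩
      obtain ⟨I, j, hinj, hj⟩ := exists_injective_embedding (S := S) (BalancedTensor S R C M)
      have hI (n) : WeakInjDimLE S n I :=
        have : Injective (ModuleCat.of S I) := hinj
        .of_injective n
      have hB : InBass S R C I := hC.inBass_of_weakInjective (hI 0)
      -- The first term comes from an embedding of `C ⊗_R M` in an injective module, transported to
      -- `M` by the unit.
      let η : M →ₗ[R] BimodHom S R C I := BimodHom.map R C j ∘ₗ foxbyUnit S R C M
      have hη : Function.Injective η := (BimodHom.map_injective hj).comp hA.unit.1
      have hs := IsShortExact.quotient hη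
      have hk : InAuslander S R C (BimodHom S R C I ⧸ LinearMap.range η) :=
        InAuslander.cokernel hC hs hA hB.inAuslander
      exact ⟨I, η, hI 0, hη, (ih _).2 ⟨hk, WeakInjDimLE.cokernel
        (hs.balancedTensor (hk.tor 0)) ((hI n).congr hB.counitEquiv.symm) hd⟩⟩

/-- A free cover lowers the dimension, and the Auslander class is closed under cokernels of
injections by faithfulness. -/
theorem InAuslander.of_weakFlatDimLE (hC : IsFaithfullySemidualizing S R C) {n : ℕ}
    (hM : WeakFlatDimLE R n M) : InAuslander S R C M := by
  induction n generalizing M with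
  | zero => exact hC.inAuslander_of_weakFlat hM
  | succ n ih =>
    have hs := IsShortExact.ker (Finsupp.linearCombination_id_surjective R M)
    exact InAuslander.cokernel hC hs (ih (WeakFlatDimLE.kernel hs (.finsupp M n) hM))
      (hC.inAuslander_of_weakFlat (.finsupp M 0))

theorem InBass.of_weakInjDimLE (hC : IsFaithfullySemidualizing S R C) {n : ℕ}
    (hN : WeakInjDimLE S n N) : InBass S R C N := by
  induction n generalizing N with
  | zero => exact hC.inBass_of_weakInjective hN
  | succ n ih =>
    obtain ⟨I, j, hinj, hj⟩ := exists_injective_embedding (S := S) N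
    have : Injective (ModuleCat.of S I) := hinj
    have hs := IsShortExact.quotient hj
    exact InBass.kernel hC hs (hC.inBass_of_weakInjective (.of_injective 0))
      (ih (WeakInjDimLE.cokernel hs (.of_injective n) hN))

end

/-- The Bass condition in `hasCWeakFlatResolution_iff` is redundant: a bound on the dimension puts
`Hom_S(C, N)` in the Auslander class, and this reflects to `N`. -/
theorem cWeakFlatDim_eq (hC : IsFaithfullySemidualizing S R C) (N : ModuleCat.{u} S) :
    cWeakFlatDim S R C N = weakFlatDim (foxbyHom R C N) := by
  have key : ∀ n : ℕ, HasCWeakFlatResolution S R C n N = WeakFlatDimLE R n (BimodHom S R C N) :=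
    fun n => propext <| (hasCWeakFlatResolution_iff hC N n).trans <|
      and_iff_right_of_imp fun h => InAuslander.inBass_of_hom hC (.of_weakFlatDimLE hC h)
  simp only [cWeakFlatDim, weakFlatDim_eq, key]

theorem cWeakInjectiveDim_eq (hC : IsFaithfullySemidualizing S R C) (M : ModuleCat.{u} R) :
    cWeakInjectiveDim S R C M = weakInjectiveDim (foxbyTensor S C M) := by
  have key : ∀ n : ℕ, HasCWeakInjectiveCoresolution S R C n M =
      WeakInjDimLE S n (BalancedTensor S R C M) :=
    fun n => propext <| (hasCWeakInjectiveCoresolution_iff hC M n).trans <|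
      and_iff_right_of_imp fun h => InBass.inAuslander_of_tensor hC (.of_weakInjDimLE hC h)
  simp only [cWeakInjectiveDim, weakInjectiveDim_eq, key]

/-- Either condition puts `M` in the Auslander class, where `M ≅ Hom_S(C, C ⊗_R M)`. -/
theorem weakFlatDim_eq_cWeakFlatDim (hC : IsFaithfullySemidualizing S R C) (M : ModuleCat.{u} R) :
    weakFlatDim M = cWeakFlatDim S R C (foxbyTensor S C M) := by
  have key : ∀ n : ℕ, HasCWeakFlatResolution S R C n (foxbyTensor S C M) =
      WeakFlatDimLE R n M := fun n => by
    refine propext ((hasCWeakFlatResolution_iff hC _ n).trans ⟨fun h => ?_, fun h => ?_⟩)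
    · exact h.2.congr (InBass.inAuslander_of_tensor hC h.1).unitEquiv.symm
    · have hA : InAuslander S R C M := .of_weakFlatDimLE hC h
      exact ⟨hA.inBass, h.congr hA.unitEquiv⟩
  simp only [cWeakFlatDim, weakFlatDim_eq, key]

theorem weakInjectiveDim_eq_cWeakInjectiveDim (hC : IsFaithfullySemidualizing S R C)
    (N : ModuleCat.{u} S) :
    weakInjectiveDim N = cWeakInjectiveDim S R C (foxbyHom R C N) := by
  have key : ∀ n : ℕ, HasCWeakInjectiveCoresolution S R C n (foxbyHom R C N) =
      WeakInjDimLE S n N := fun n => by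
    refine propext ((hasCWeakInjectiveCoresolution_iff hC _ n).trans ⟨fun h => ?_, fun h => ?_⟩)
    · exact h.2.congr (InAuslander.inBass_of_hom hC h.1).counitEquiv
    · have hB : InBass S R C N := .of_weakInjDimLE hC h
      exact ⟨hB.inAuslander, h.congr hB.counitEquiv.symm⟩
  simp only [cWeakInjectiveDim, weakInjectiveDim_eq, key]

end Resolutions

theorem proposition3p5 {R S C : Type u} [Ring R] [Ring S] [AddCommGroup C] [Module S C]
    [Module Rᵐᵒᵖ C] [SMulCommClass S Rᵐᵒᵖ C] (hC : IsFaithfullySemidualizing S R C) :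
    (∀ M : ModuleCat.{u} R, weakFlatDim M = cWeakFlatDim S R C (foxbyTensor S C M)) ∧
    (∀ M : ModuleCat.{u} S, weakInjectiveDim M = cWeakInjectiveDim S R C (foxbyHom R C M)) ∧
    (∀ M : ModuleCat.{u} R, cWeakInjectiveDim S R C M = weakInjectiveDim (foxbyTensor S C M)) ∧
    (∀ M : ModuleCat.{u} S, cWeakFlatDim S R C M = weakFlatDim (foxbyHom R C M)) :=
  ⟨weakFlatDim_eq_cWeakFlatDim hC, weakInjectiveDim_eq_cWeakInjectiveDim hC,
    cWeakInjectiveDim_eq hC, cWeakFlatDim_eq hC⟩
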